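/- Let $(M,g)$ be an oriented smooth Riemannian surface. Let $F_1,F_2:(M,g)\to\mathbb R^3$ be smooth isometric immersions, with smooth unit normal fields $N_1,N_2$, second fundamental forms $\mathrm{II}_i(v,w)=-\langle dN_i(v),dF_i(w)\rangle$ and mean curvature functions $H_i=\tfrac12\operatorname{tr}_g\mathrm{II}_i$. (a) If $H_1=H_2$ on $M$, then the shape distortion tensor $D=\mathrm{II}_1-\mathrm{II}_2$ is trace-free, $\operatorname{tr}_gD=0$, and divergence-free, $\operatorname{div}_gD=0$ (divergence with respect to the Levi-Civita connection of $g$), and its $(2,0)$ part $D^{2,0}$ is a holomorphic quadratic differential: in every positively oriented isothermal coordinate $z=x+iy$ of $(M,g)$ one has $D^{2,0}=q\,dz^2$ with $q=D(\partial_z,\partial_z)$ holomorphic, where $\partial_z=\tfrac12(\partial_x-i\partial_y)$ and $D$ is extended complex-bilinearly. (b) For trace-free tensors the last two properties are equivalent: if $z$ is a positively oriented isothermal coordinate with domain $U\subseteq M$, and $S$ is a symmetric, trace-free, $C^1$ covariant two-tensor on $U$, then $\operatorname{div}_gS=0$ on $U$ if and only if $S^{2,0}=S(\partial_z,\partial_z)\,dz^2$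 is holomorphic on $U$. -/

import Mathlib

open Bundle
open scoped Manifold ContDiff

noncomputable section

namespace BonnetSurface

/-- The plane, model space of surfaces. -/
abbrev Plane : Type := EuclideanSpace ℝ (Fin 2)

/-- Euclidean three-space, the ambient space. -/
abbrev Space : Type := EuclideanSpace ℝ (Fin 3)

/-- The coordinate vectors of the plane. -/
abbrev stdVec (i : Fin 2) : Plane := EuclideanSpace.single i (1 : ℝ)

section

variable {M : Type*} [TopologicalSpace M] [ChartedSpace Plane M]

variable (M) in
/-- Smooth Riemannian metrics on the surface `M`. -/
abbrev Metric [IsManifold (𝓡 2) ∞ M] : Type _ :=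
  ContMDiffRiemannianMetric (𝓡 2) ∞ Plane (TangentSpace (𝓡 2) : M → Type _)

variable (M) in
/-- Covariant two-tensor fields on the surface `M` (no regularity or symmetry imposed). -/
abbrev TwoTensor : Type _ :=
  (p : M) → TangentSpace (𝓡 2) p →L[ℝ] TangentSpace (𝓡 2) p →L[ℝ] ℝ

/-- The two-tensor field `S` is continuously differentiable on `U`. -/
def IsC1On [IsManifold (𝓡 2) ∞ M] (S : TwoTensor M) (U : Set M) : Prop :=
  ContMDiffOn (𝓡 2) ((𝓡 2).prod 𝓘(ℝ, Plane →L[ℝ] Plane →L[ℝ] ℝ)) 1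
    (fun p ↦ (TotalSpace.mk' (Plane →L[ℝ] Plane →L[ℝ] ℝ) p (S p) :
      TotalSpace (Plane →L[ℝ] Plane →L[ℝ] ℝ)
        (fun p : M ↦ TangentSpace (𝓡 2) p →L[ℝ] TangentSpace (𝓡 2) p →L[ℝ] ℝ))) U

/-- The two-tensor field `S` is symmetric on `U`. -/
def IsSymmetricOn (S : TwoTensor M) (U : Set M) : Prop :=
  ∀ p ∈ U, ∀ v w : TangentSpace (𝓡 2) p, S p v w = S p w v

/-! ### Orientations -/

variable (M) in
/-- An orientation of the smooth surface `M`, given by a covering family of smooth charts whose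
transition maps all have positive Jacobian determinant. -/
structure OrientedAtlas where
  charts : Set (OpenPartialHomeomorph M Plane)
  smooth : ∀ φ ∈ charts, φ ∈ IsManifold.maximalAtlas (𝓡 2) ∞ M
  cover : ∀ p : M, ∃ φ ∈ charts, p ∈ φ.source
  pos : ∀ φ ∈ charts, ∀ ψ ∈ charts, ∀ p ∈ φ.source ∩ ψ.source,
    0 < (fderiv ℝ (ψ ∘ φ.symm) (φ p)).det

/-- A chart is positively oriented if it has positive Jacobian determinant with respect to all
charts of the oriented atlas. -/
def OrientedAtlas.IsPositive (o : OrientedAtlas M) (z : OpenPartialHomeomorph M Plane) : Prop :=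
  ∀ φ ∈ o.charts, ∀ p ∈ φ.source ∩ z.source, 0 < (fderiv ℝ (z ∘ φ.symm) (φ p)).det

/-! ### Traces and mean curvature -/

section Metric

variable [IsManifold (𝓡 2) ∞ M] (g : Metric M)

/-- The trace `∑ i j, g^{ij} S(e_i, e_j)` of the two-tensor field `S` at `p` with respect to the
metric `g`, where `g^{ij}` is the inverse of the Gram matrix `g(e_i, e_j)` and `e` is the
standard basis of the tangent space at `p`. (The value does not depend on the basis.) -/
def trace (S : TwoTensor M) (p : M) : ℝ :=
  let e : Fin 2 → TangentSpace (𝓡 2) p := stdVec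
  let G : Matrix (Fin 2) (Fin 2) ℝ := Matrix.of fun i j ↦ g.inner p (e i) (e j)
  ∑ i, ∑ j, G⁻¹ i j * S p (e i) (e j)

/-- `S` is trace-free on `U`. -/
def IsTraceFreeOn (S : TwoTensor M) (U : Set M) : Prop :=
  ∀ p ∈ U, trace g S p = 0

/-- `F` is a (smooth) isometric immersion of `(M, g)` into Euclidean three-space. -/
structure IsIsometricImmersion (F : M → Space) : Prop where
  smooth : ContMDiff (𝓡 2) (𝓡 3) ∞ F
  isometric : ∀ (p : M) (v w : TangentSpace (𝓡 2) p),
    inner ℝ (mfderiv (𝓡 2) (𝓡 3) F p v : Space) (mfderiv (𝓡 2) (𝓡 3) F p w : Space) =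
      g.inner p v w

end Metric

/-- `N` is a smooth field of unit normals along `F`. -/
structure IsUnitNormalField (F N : M → Space) : Prop where
  smooth : ContMDiff (𝓡 2) (𝓡 3) ∞ N
  norm_eq_one : ∀ p : M, ‖N p‖ = 1
  normal : ∀ (p : M) (v : TangentSpace (𝓡 2) p),
    inner ℝ (mfderiv (𝓡 2) (𝓡 3) F p v : Space) (N p) = 0

/-- The second fundamental form `II(v, w) = -⟨dN(v), dF(w)⟩` of the immersion `F` with field of
unit normals `N`. -/
def secondFundamentalForm (F N : M → Space) : TwoTensor M := fun p ↦
  let dF : Plane →L[ℝ] Space := mfderiv (𝓡 2) (𝓡 3) F p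
  let dN : Plane →L[ℝ] Space := mfderiv (𝓡 2) (𝓡 3) N p
  let B : Plane →L[ℝ] Plane →L[ℝ] ℝ := -(innerSL ℝ).bilinearComp dN dF
  B

/-- The mean curvature function `H = (1/2) tr_g II`. -/
def meanCurvature [IsManifold (𝓡 2) ∞ M] (g : Metric M) (F N : M → Space) (p : M) : ℝ :=
  (1 / 2) * trace g (secondFundamentalForm F N) p

/-- The shape distortion tensor `D = II₁ - II₂`. -/
def shapeDistortion (F₁ N₁ F₂ N₂ : M → Space) : TwoTensor M := fun p ↦
  secondFundamentalForm F₁ N₁ p - secondFundamentalForm F₂ N₂ p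

/-! ### Local coordinates, Levi-Civita connection and divergence -/

/-- The coordinate vector field `∂_i` of the chart `φ`, at the point with coordinates `u`. -/
def coordVec (φ : OpenPartialHomeomorph M Plane) (i : Fin 2) (u : Plane) :
    TangentSpace (𝓡 2) (φ.symm u) :=
  mfderiv (𝓡 2) (𝓡 2) φ.symm u (stdVec i)

/-- The component `S_{ij} = S(∂_i, ∂_j)` of a two-tensor field in the chart `φ`, as a function of
the coordinates. -/
def comp (S : TwoTensor M) (φ : OpenPartialHomeomorph M Plane) (i j : Fin 2) (u : Plane) : ℝ :=
  S (φ.symm u) (coordVec φ i u) (coordVec φ j u)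

/-- Partial derivative `∂_i f` of a function of the coordinates. -/
def partialD (i : Fin 2) (f : Plane → ℝ) (u : Plane) : ℝ :=
  fderiv ℝ f u (stdVec i)

variable [IsManifold (𝓡 2) ∞ M] (g : Metric M)

/-- The inverse matrix `g^{ij}` of the metric components `g_{ij}` in the chart `φ`. -/
def invMetric (φ : OpenPartialHomeomorph M Plane) (u : Plane) : Matrix (Fin 2) (Fin 2) ℝ :=
  (Matrix.of fun i j ↦ comp g.inner φ i j u)⁻¹

/-- The Christoffel symbols `Γ^k_{ij} = (1/2) ∑_l g^{kl} (∂_i g_{jl} + ∂_j g_{il} - ∂_l g_{ij})` of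
the Levi-Civita connection of `g` in the chart `φ`. -/
def christoffel (φ : OpenPartialHomeomorph M Plane) (k i j : Fin 2) (u : Plane) : ℝ :=
  (1 / 2) * ∑ l, invMetric g φ u k l *
    (partialD i (comp g.inner φ j l) u + partialD j (comp g.inner φ i l) u
      - partialD l (comp g.inner φ i j) u)

/-- The components `∇_k S_{ij} = ∂_k S_{ij} - ∑_l Γ^l_{ki} S_{lj} - ∑_l Γ^l_{kj} S_{il}` of the
covariant derivative of `S` with respect to the Levi-Civita connection of `g`. -/
def covDeriv (S : TwoTensor M) (φ : OpenPartialHomeomorph M Plane) (k i j : Fin 2)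
    (u : Plane) : ℝ :=
  partialD k (comp S φ i j) u - ∑ l, christoffel g φ l k i u * comp S φ l j u
    - ∑ l, christoffel g φ l k j u * comp S φ i l u

/-- The components `(div S)_j = ∑_{i,k} g^{ki} ∇_k S_{ij}` of the divergence of `S`. -/
def divergence (S : TwoTensor M) (φ : OpenPartialHomeomorph M Plane) (j : Fin 2)
    (u : Plane) : ℝ :=
  ∑ k, ∑ i, invMetric g φ u k i * covDeriv g S φ k i j u

/-- `S` is divergence-free on `U`: the one-form `div S` vanishes at every point of `U`, that is, its
components with respect to every smooth chart vanish there. -/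
def IsDivergenceFreeOn (S : TwoTensor M) (U : Set M) : Prop :=
  ∀ φ ∈ IsManifold.maximalAtlas (𝓡 2) ∞ M, ∀ p ∈ φ.source ∩ U, ∀ j : Fin 2,
    divergence g S φ j (φ p) = 0

/-! ### The `(2,0)` part -/

/-- `z = x + i y` is a holomorphic coordinate of the Riemann surface determined by `g` and the
orientation: a smooth positively oriented chart in which `g = λ (dx² + dy²)`. -/
structure IsIsothermal (o : OrientedAtlas M) (z : OpenPartialHomeomorph M Plane) : Prop where
  smooth : z ∈ IsManifold.maximalAtlas (𝓡 2) ∞ M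
  positive : o.IsPositive z
  diag : ∀ u ∈ z.target, comp g.inner z 0 0 u = comp g.inner z 1 1 u
  offDiag : ∀ u ∈ z.target, comp g.inner z 0 1 u = 0

/-- The point of the plane with complex coordinate `ζ`. -/
def ofComplex (ζ : ℂ) : Plane := !₂[ζ.re, ζ.im]

/-- The complex-bilinear extension of `S` to the complexified tangent space at `p`, evaluated at
`a + i b` and `c + i d`. -/
def complexExtension (S : TwoTensor M) (p : M) (a b c d : TangentSpace (𝓡 2) p) : ℂ :=
  ((S p a c - S p b d : ℝ) : ℂ) + ((S p a d + S p b c : ℝ) : ℂ) * Complex.I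

/-- The coefficient `q = S(∂_z, ∂_z)`, with `∂_z = (∂_x - i ∂_y) / 2`, of the `(2,0)` part
`S^{2,0} = q dz²` of `S` with respect to the coordinate `z`, as a function of the complex
coordinate. -/
def twoZeroCoeff (S : TwoTensor M) (z : OpenPartialHomeomorph M Plane) (ζ : ℂ) : ℂ :=
  let u := ofComplex ζ
  let a : TangentSpace (𝓡 2) (z.symm u) := (1 / 2 : ℝ) • coordVec z 0 u
  let b : TangentSpace (𝓡 2) (z.symm u) := -((1 / 2 : ℝ) • coordVec z 1 u)
  complexExtension S (z.symm u) a b a b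

/-- The `(2,0)` part `S^{2,0} = q dz²` is holomorphic in the coordinate `z`: the coefficient `q` is a
holomorphic function on the image of `z`. -/
def IsHolomorphicIn (S : TwoTensor M) (z : OpenPartialHomeomorph M Plane) : Prop :=
  DifferentiableOn ℂ (twoZeroCoeff S z) (ofComplex ⁻¹' z.target)

/-- The `(2,0)` part of `S` is a holomorphic quadratic differential on the Riemann surface determined
by `g` and the orientation: `S^{2,0} = q dz²` with `q` holomorphic, in every holomorphic coordinate
`z`. -/
def IsHolomorphicTwoZero (o : OrientedAtlas M) (S : TwoTensor M) : Prop :=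
  ∀ z : OpenPartialHomeomorph M Plane, IsIsothermal g o z → IsHolomorphicIn S z

end

end BonnetSurface

end

/-! Equal mean curvatures make `D` trace-free at once. Each second fundamental form satisfies the
Codazzi equation: `∇_k II_{ij}` is symmetric in `k` and `i`. Both immersions induce the same metric,
so both equations use the same Levi-Civita connection and `D` is again a Codazzi tensor. Hence `(div
D)_j = g^{ki} ∇_k D_{ij} = g^{ki} ∇_j D_{ki} = ∂_j (tr D) = 0`. The lemmas are `covDerivAt_sff_comm`
(Codazzi), `contract_covDerivAt_eq_zero` (contraction commutes with `∇`) and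
`divergence_eq_zero_of_codazzi`.

For holomorphy, let `g = λ (dx² + dy²)` and let `S` be symmetric and trace-free. The Christoffel
terms of the divergence cancel, leaving `(div S)_j = λ⁻¹ ∑ ∂_k S_{kj}`
(`IsIsothermal.divergence_eq`). Since `S_{11} = -S_{00}`, the coefficient is `q = (S_{00} - i
S_{01}) / 2`, and its Cauchy-Riemann equations are exactly the vanishing of the two components of
this divergence. This proves (b), and the last claim of (a) follows from it.

Divergence-freeness is required in every smooth chart, whereas the computation lives in one
isothermal chart. The bridge is `divergence_eq_sum`: the divergence computed from Christoffel
symbols transforms as a one-form. Its content is algebra at a point, carried out on numerical arrays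
standing for components and their derivatives. -/

namespace BonnetSurface

/-! ### Tensor algebra at a point -/

/-- The Christoffel symbols determined by the inverse Gram matrix and the first
derivatives `dg k i j = ∂_k g_{ij}` of the metric components at a point. -/
noncomputable def christoffelAt (Ginv : Fin 2 → Fin 2 → ℝ) (dg : Fin 2 → Fin 2 → Fin 2 → ℝ)
    (k i j : Fin 2) : ℝ :=
  (1 / 2) * ∑ l, Ginv k l * (dg i j l + dg j i l - dg l i j)

/-- The components of the covariant derivative of a two-tensor with components `S` and first
derivatives `dS` at a point, with Christoffel symbols `Γ`. -/
def covDerivAt (Γ : Fin 2 → Fin 2 → Fin 2 → ℝ) (S : Fin 2 → Fin 2 → ℝ)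
    (dS : Fin 2 → Fin 2 → Fin 2 → ℝ) (k i j : Fin 2) : ℝ :=
  dS k i j - ∑ l, Γ l k i * S l j - ∑ l, Γ l k j * S i l

/-- The contraction of a covariant derivative `C` with the inverse metric. -/
def divergenceAt (Ginv : Fin 2 → Fin 2 → ℝ) (C : Fin 2 → Fin 2 → Fin 2 → ℝ)
    (j : Fin 2) : ℝ :=
  ∑ k, ∑ i, Ginv k i * C k i j

/-- The components `S_{ab} A^a_i A^b_j` of the pull-back of a two-tensor by a linear map. -/
def pullTwo (A : Fin 2 → Fin 2 → ℝ) (S : Fin 2 → Fin 2 → ℝ) (i j : Fin 2) : ℝ :=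
  ∑ a, ∑ b, S a b * A a i * A b j

/-- The derivatives of the components of the pull-back of a two-tensor field by a map with first
derivatives `A a i = ∂_i τ^a` and second derivatives `h a i j = ∂_i ∂_j τ^a`. -/
def pullTwoDeriv (A : Fin 2 → Fin 2 → ℝ) (h : Fin 2 → Fin 2 → Fin 2 → ℝ) (S : Fin 2 → Fin 2 → ℝ)
    (dS : Fin 2 → Fin 2 → Fin 2 → ℝ) (k i j : Fin 2) : ℝ :=
  ∑ a, ∑ b, ((∑ c, dS c a b * A c k) * A a i * A b j + S a b * h a k i * A b j
    + S a b * A a i * h b k j)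

/-- The inhomogeneous transformation law of the Christoffel symbols. With the upper index lowered,
symmetry of `h` cancels all second-derivative terms except `G(h_{ij}, A_l)`; raising the index turns
that one into `h c i j`. -/
theorem christoffelAt_pull {A : Fin 2 → Fin 2 → ℝ} {h : Fin 2 → Fin 2 → Fin 2 → ℝ}
    {G : Fin 2 → Fin 2 → ℝ} {dg : Fin 2 → Fin 2 → Fin 2 → ℝ}
    {Ginv Ginv' : Fin 2 → Fin 2 → ℝ}
    (hh : ∀ a i j, h a i j = h a j i) (hG : ∀ a b, G a b = G b a)
    (hdg : ∀ c a b, dg c a b = dg c b a) 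
    (hinv : ∀ d b, ∑ x, Ginv d x * G x b = if d = b then 1 else 0)
    (hinv' : ∀ c d, Ginv c d = ∑ k, ∑ l, A c k * Ginv' k l * A d l) (c i j : Fin 2) :
    ∑ k, A c k * christoffelAt Ginv' (pullTwoDeriv A h G dg) k i j =
      ∑ a, ∑ b, christoffelAt Ginv dg c a b * A a i * A b j + h c i j := by
  have low : ∀ l, (1 / 2) * (pullTwoDeriv A h G dg i j l + pullTwoDeriv A h G dg j i l
      - pullTwoDeriv A h G dg l i j) =
      ∑ d, A d l * ((∑ a, ∑ b, (1 / 2) * (dg a b d + dg b a d - dg d a b) * A a i * A b j)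
        + ∑ b, G d b * h b i j) := by
    intro l
    simp only [pullTwoDeriv, Fin.sum_univ_two]
    rw [hG 1 0, hdg 0 1 0, hdg 1 1 0, hh 0 j i, hh 1 j i, hh 0 l i, hh 1 l i, hh 0 l j, hh 1 l j]
    ring
  have key : ∑ k, A c k * christoffelAt Ginv' (pullTwoDeriv A h G dg) k i j =
      ∑ d, Ginv c d * ((∑ a, ∑ b, (1 / 2) * (dg a b d + dg b a d - dg d a b) * A a i * A b j)
        + ∑ b, G d b * h b i j) := by
    have : ∀ k, christoffelAt Ginv' (pullTwoDeriv A h G dg) k i j = ∑ l, Ginv' k l *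
        ((1 / 2) * (pullTwoDeriv A h G dg i j l + pullTwoDeriv A h G dg j i l
      - pullTwoDeriv A h G dg l i j)) := by
      intro k
      simp only [christoffelAt, Fin.sum_univ_two]
      ring
    simp only [this, low, hinv']
    simp only [Fin.sum_univ_two]
    ring
  rw [key]
  have e1 : ∑ d, Ginv c d * ∑ b, G d b * h b i j = h c i j := by
    have : ∑ d, Ginv c d * ∑ b, G d b * h b i j = ∑ b, (∑ x, Ginv c x * G x b) * h b i j := by
      simp only [Fin.sum_univ_two]; ring
    rw [this]; simp [hinv]
  simp only [mul_add, Finset.sum_add_distrib, e1]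
  simp only [christoffelAt, Fin.sum_univ_two]
  ring

/-- The terms in `h` coming from the derivative of the pulled-back components cancel those coming
from the Christoffel symbols, so the covariant derivative is a tensor. -/
theorem covDerivAt_pull {A : Fin 2 → Fin 2 → ℝ} {h Γ Γ' : Fin 2 → Fin 2 → Fin 2 → ℝ}
    (hΓ : ∀ c i j, ∑ k, A c k * Γ' k i j = ∑ a, ∑ b, Γ c a b * A a i * A b j + h c i j)
    (S : Fin 2 → Fin 2 → ℝ) (dS : Fin 2 → Fin 2 → Fin 2 → ℝ) (k i j : Fin 2) :
    covDerivAt Γ' (pullTwo A S) (pullTwoDeriv A h S dS) k i j =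
      ∑ c, ∑ a, ∑ b, covDerivAt Γ S dS c a b * A c k * A a i * A b j := by
  have e1 : ∑ l, Γ' l k i * pullTwo A S l j =
      ∑ a, ∑ b, S a b * (∑ l, A a l * Γ' l k i) * A b j := by
    simp only [pullTwo, Fin.sum_univ_two]; ring
  have e2 : ∑ l, Γ' l k j * pullTwo A S i l =
      ∑ a, ∑ b, S a b * A a i * (∑ l, A b l * Γ' l k j) := by
    simp only [pullTwo, Fin.sum_univ_two]; ring
  rw [covDerivAt, e1, e2]
  simp only [hΓ]
  simp only [covDerivAt, pullTwoDeriv, Fin.sum_univ_two]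
  ring

theorem divergenceAt_pull {A : Fin 2 → Fin 2 → ℝ} {C C' : Fin 2 → Fin 2 → Fin 2 → ℝ}
    {Ginv Ginv' : Fin 2 → Fin 2 → ℝ}
    (hinv' : ∀ c d, Ginv c d = ∑ k, ∑ l, A c k * Ginv' k l * A d l)
    (hC : ∀ k i j, C' k i j = ∑ c, ∑ a, ∑ b, C c a b * A c k * A a i * A b j) (j : Fin 2) :
    divergenceAt Ginv' C' j = ∑ b, divergenceAt Ginv C b * A b j := by
  simp only [divergenceAt, hinv', hC, Fin.sum_univ_two]
  ring

/-! ### Components in a chart -/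

section Chart

variable {M : Type*} [TopologicalSpace M] [ChartedSpace Plane M] [IsManifold (𝓡 2) ∞ M]

theorem contMDiffOn_coordVec {φ : OpenPartialHomeomorph M Plane}
    (hφ : φ ∈ IsManifold.maximalAtlas (𝓡 2) ∞ M) (i : Fin 2) :
    ContMDiffOn (𝓡 2) (𝓡 2).tangent ∞
      (fun u ↦ (⟨φ.symm u, coordVec φ i u⟩ : TangentBundle (𝓡 2) M)) φ.target := by
  have h1 := contMDiffOn_symm_of_mem_maximalAtlas hφ
  have h2 := h1.contMDiffOn_tangentMapWithin (m := ∞) (by simp) φ.open_target.uniqueMDiffOn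
  have h3 : ContMDiffOn (𝓡 2) (𝓡 2).tangent ∞
      (fun u ↦ (⟨u, stdVec i⟩ : TangentBundle (𝓡 2) Plane)) φ.target :=
    contMDiffOn_vectorSpace_iff_contDiffOn.2 contDiffOn_const
  refine (h2.comp h3 fun u hu ↦ hu).congr fun u hu ↦ ?_
  simp only [Function.comp, tangentMapWithin, coordVec]
  rw [mfderivWithin_of_isOpen φ.open_target hu]

theorem contDiffOn_comp {S : TwoTensor M} {φ : OpenPartialHomeomorph M Plane}
    (hφ : φ ∈ IsManifold.maximalAtlas (𝓡 2) ∞ M) (hS : IsC1On S φ.source) (i j : Fin 2) :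
    ContDiffOn ℝ 1 (comp S φ i j) φ.target := by
  have h1 := (contMDiffOn_symm_of_mem_maximalAtlas hφ).of_le (n := ∞) (m := 1) (by simp)
  have h2 := hS.comp h1 fun u hu ↦ φ.map_target hu
  have h3 := ContMDiffOn.clm_bundle_apply₂ (E₃ := Bundle.Trivial M ℝ) (F₃ := ℝ) h2
    ((contMDiffOn_coordVec hφ i).of_le (by simp)) ((contMDiffOn_coordVec hφ j).of_le (by simp))
  intro u hu
  have h4 := h3 u hu
  simp only [contMDiffWithinAt_totalSpace] at h4
  exact h4.2.contDiffWithinAt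

end Chart

/-! ### Gram matrices and traces under a change of frame -/

/-- Here `G' = Aᵀ G A`, and `det G' ≠ 0` forces `A` to be invertible, so the relation can be
inverted. -/
theorem inv_apply_eq_of_pullTwo {A : Fin 2 → Fin 2 → ℝ} {G G' : Matrix (Fin 2) (Fin 2) ℝ}
    (h : ∀ i j, G' i j = pullTwo A G i j) (hG' : G'.det ≠ 0) (c d : Fin 2) :
    G⁻¹ c d = ∑ k, ∑ l, A c k * G'⁻¹ k l * A d l := by
  have e : G' = (Matrix.of A).transpose * G * Matrix.of A := by
    ext i j
    simp only [h, pullTwo, Matrix.mul_apply, Matrix.transpose_apply, Matrix.of_apply,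
      Fin.sum_univ_two]
    ring
  have hA : IsUnit (Matrix.of A).det := by
    rw [isUnit_iff_ne_zero]
    intro h0
    apply hG'
    rw [e, Matrix.det_mul, h0, mul_zero]
  have e2 : G⁻¹ = Matrix.of A * G'⁻¹ * (Matrix.of A).transpose := by
    have hAt : IsUnit (Matrix.of A).transpose.det := by rwa [Matrix.det_transpose]
    rw [e, Matrix.mul_inv_rev, Matrix.mul_inv_rev, Matrix.mul_nonsing_inv_cancel_left _ _ hA,
      Matrix.mul_assoc, Matrix.nonsing_inv_mul _ hAt, Matrix.mul_one]
  rw [e2]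
  simp only [Matrix.mul_apply, Matrix.transpose_apply, Matrix.of_apply, Fin.sum_univ_two]
  ring

theorem pullTwo_contract {A S S' : Fin 2 → Fin 2 → ℝ} {G G' : Matrix (Fin 2) (Fin 2) ℝ}
    (h : ∀ i j, G' i j = pullTwo A G i j) (hG' : G'.det ≠ 0)
    (hS : ∀ i j, S' i j = pullTwo A S i j) :
    ∑ i, ∑ j, G'⁻¹ i j * S' i j = ∑ i, ∑ j, G⁻¹ i j * S i j := by
  simp only [inv_apply_eq_of_pullTwo h hG', hS, pullTwo, Fin.sum_univ_two]
  ring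

theorem bilin_eq_pullTwo (B : Plane →L[ℝ] Plane →L[ℝ] ℝ) {v w : Fin 2 → Plane}
    {A : Fin 2 → Fin 2 → ℝ} (h : ∀ i, v i = ∑ a, A a i • w a) (i j : Fin 2) :
    B (v i) (v j) = pullTwo A (fun a b ↦ B (w a) (w b)) i j := by
  simp only [h, pullTwo, Fin.sum_univ_two, map_add, map_smul, add_apply,
    smul_apply, smul_eq_mul]
  ring

theorem eq_sum_stdVec (v : Plane) : v = ∑ a, v a • stdVec a := by
  ext i; fin_cases i <;> simp [Fin.sum_univ_two, stdVec]

section Chart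

variable {M : Type*} [TopologicalSpace M] [ChartedSpace Plane M]
  {φ z : OpenPartialHomeomorph M Plane}

theorem mfderiv_symm_injective (hφ : φ ∈ IsManifold.maximalAtlas (𝓡 2) ∞ M) {u : Plane}
    (hu : u ∈ φ.target) : Function.Injective (mfderiv (𝓡 2) (𝓡 2) φ.symm u) := by
  have h : φ.MDifferentiable (𝓡 2) (𝓡 2) :=
    ⟨(contMDiffOn_of_mem_maximalAtlas hφ).mdifferentiableOn (by simp),
      (contMDiffOn_symm_of_mem_maximalAtlas hφ).mdifferentiableOn (by simp)⟩
  exact h.symm.mfderiv_injective hu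

theorem linearIndependent_coordVec (hφ : φ ∈ IsManifold.maximalAtlas (𝓡 2) ∞ M) {u : Plane}
    (hu : u ∈ φ.target) : LinearIndependent ℝ fun i ↦ coordVec φ i u := by
  have h : LinearIndependent ℝ stdVec := by
    convert! (EuclideanSpace.basisFun (Fin 2) ℝ).toBasis.linearIndependent using 1
    ext i : 1
    simp [stdVec]
  exact h.map' (mfderiv (𝓡 2) (𝓡 2) φ.symm u).toLinearMap
    (LinearMap.ker_eq_bot.2 (mfderiv_symm_injective hφ hu))

variable [IsManifold (𝓡 2) ∞ M]

theorem gram_det_ne_zero (g : Metric M) (p : M) {v : Fin 2 → TangentSpace (𝓡 2) p}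
    (hv : LinearIndependent ℝ v) :
    (Matrix.of fun i j ↦ g.inner p (v i) (v j)).det ≠ 0 := by
  intro h0
  obtain ⟨x, hx, hx0⟩ := Matrix.exists_mulVec_eq_zero_iff.2 h0
  apply hx
  -- A kernel vector `x` of the Gram matrix gives a tangent vector of length zero.
  have h1 : g.inner p (∑ i, x i • v i) (∑ i, x i • v i) = 0 := by
    have e := fun i ↦ congrFun hx0 i
    simp only [Matrix.mulVec, dotProduct, Matrix.of_apply, Pi.zero_apply, Fin.sum_univ_two] at e
    simp only [Fin.sum_univ_two, map_add, map_smul, add_apply,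
      smul_apply, smul_eq_mul]
    linear_combination x 0 * e 0 + x 1 * e 1
  have h2 : ∑ i, x i • v i = 0 := by
    by_contra h
    exact (g.pos p _ h).ne' h1
  funext i
  exact Fintype.linearIndependent_iff.1 hv x h2 i

theorem metric_comp_det_ne_zero (g : Metric M) (hφ : φ ∈ IsManifold.maximalAtlas (𝓡 2) ∞ M)
    {u : Plane} (hu : u ∈ φ.target) :
    (Matrix.of fun i j ↦ comp g.inner φ i j u).det ≠ 0 :=
  gram_det_ne_zero g _ (linearIndependent_coordVec hφ hu)

/-- The trace of a two-tensor in terms of its components in a chart. -/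
theorem trace_eq_comp (g : Metric M) (S : TwoTensor M)
    (hφ : φ ∈ IsManifold.maximalAtlas (𝓡 2) ∞ M) {u : Plane} (hu : u ∈ φ.target) :
    trace g S (φ.symm u) = ∑ i, ∑ j, invMetric g φ u i j * comp S φ i j u := by
  -- The `id` serves to regard a tangent vector as an element of the model space `Plane`.
  have h : ∀ i, (id (coordVec φ i u) : Plane) = ∑ a, (id (coordVec φ i u) : Plane) a • stdVec a :=
    fun i ↦ eq_sum_stdVec _
  exact (pullTwo_contract (bilin_eq_pullTwo (g.inner (φ.symm u)) h)
    (metric_comp_det_ne_zero g hφ hu) (bilin_eq_pullTwo (S (φ.symm u)) h)).symm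

end Chart

/-! ### Change of chart -/

section Calculus

variable {E : Type*} [NormedAddCommGroup E] [NormedSpace ℝ E]

theorem differentiableAt_fderiv_apply {f : Plane → E} {u : Plane} (hf : ContDiffAt ℝ 2 f u)
    (x : Plane) : DifferentiableAt ℝ (fun v ↦ fderiv ℝ f v x) u :=
  ((hf.fderiv_right (m := 1) (by norm_num)).differentiableAt (by norm_num)).clm_apply
    (differentiableAt_const x)

theorem fderiv_fderiv_comm {f : Plane → E} {u : Plane} (hf : ContDiffAt ℝ 2 f u) (x y : Plane) :
    fderiv ℝ (fun v ↦ fderiv ℝ f v x) u y = fderiv ℝ (fun v ↦ fderiv ℝ f v y) u x := by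
  have h1 : DifferentiableAt ℝ (fderiv ℝ f) u :=
    (hf.fderiv_right (m := 1) (by norm_num)).differentiableAt (by norm_num)
  have h2 : ∀ x, fderiv ℝ (fun v ↦ fderiv ℝ f v x) u = (fderiv ℝ (fderiv ℝ f) u).flip x := by
    intro x
    ext y
    rw [fderiv_clm_apply h1 (differentiableAt_const x)]
    simp
  have h3 := (hf.isSymmSndFDerivAt (by simp)).eq x y
  rw [h2, h2]
  exact h3.symm

theorem partialD_comp {f : Plane → ℝ} {τ : Plane → Plane} {u : Plane}
    (hf : DifferentiableAt ℝ f (τ u)) (hτ : DifferentiableAt ℝ τ u) (k : Fin 2) :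
    partialD k (fun v ↦ f (τ v)) u =
      ∑ c, partialD c f (τ u) * partialD k (fun v ↦ τ v c) u := by
  have h1 : fderiv ℝ (fun v ↦ f (τ v)) u = (fderiv ℝ f (τ u)).comp (fderiv ℝ τ u) :=
    fderiv_comp u hf hτ
  have h2 : ∀ c, partialD k (fun v ↦ τ v c) u = fderiv ℝ τ u (stdVec k) c := fun c ↦ by
    have := ((EuclideanSpace.proj c : Plane →L[ℝ] ℝ).hasFDerivAt.comp u hτ.hasFDerivAt).fderiv
    exact congrArg (fun L : Plane →L[ℝ] ℝ ↦ L (stdVec k)) this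
  simp only [partialD, h1, ContinuousLinearMap.comp_apply]
  rw [eq_sum_stdVec (fderiv ℝ τ u (stdVec k))]
  simp only [map_sum, map_smul, smul_eq_mul, ← h2, partialD]
  exact Finset.sum_congr rfl fun _ _ ↦ mul_comm _ _

theorem partialD_congr {f f' : Plane → ℝ} {u : Plane} (h : f =ᶠ[nhds u] f') (k : Fin 2) :
    partialD k f u = partialD k f' u := by
  rw [partialD, h.fderiv_eq, partialD]

theorem partialD_mul {f f' : Plane → ℝ} {u : Plane} (hf : DifferentiableAt ℝ f u)
    (hf' : DifferentiableAt ℝ f' u) (k : Fin 2) :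
    partialD k (fun v ↦ f v * f' v) u = partialD k f u * f' u + f u * partialD k f' u := by
  rw [partialD, fderiv_fun_mul hf hf']
  simp only [partialD, add_apply, smul_apply, smul_eq_mul]
  ring

theorem partialD_add {f f' : Plane → ℝ} {u : Plane} (hf : DifferentiableAt ℝ f u)
    (hf' : DifferentiableAt ℝ f' u) (k : Fin 2) :
    partialD k (fun v ↦ f v + f' v) u = partialD k f u + partialD k f' u := by
  rw [partialD, fderiv_fun_add hf hf']
  simp only [partialD, add_apply]

theorem partialD_sub {f f' : Plane → ℝ} {u : Plane} (hf : DifferentiableAt ℝ f u)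
    (hf' : DifferentiableAt ℝ f' u) (k : Fin 2) :
    partialD k (fun v ↦ f v - f' v) u = partialD k f u - partialD k f' u := by
  rw [partialD, fderiv_fun_sub hf hf']
  simp only [partialD, sub_apply]

theorem partialD_pullTwo {A T : Fin 2 → Fin 2 → Plane → ℝ} {u : Plane}
    (hA : ∀ a i, DifferentiableAt ℝ (A a i) u) (hT : ∀ a b, DifferentiableAt ℝ (T a b) u)
    (k i j : Fin 2) :
    partialD k (fun v ↦ pullTwo (fun a i ↦ A a i v) (fun a b ↦ T a b v) i j) u =
      ∑ a, ∑ b, (partialD k (T a b) u * A a i u * A b j u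
        + T a b u * partialD k (A a i) u * A b j u
        + T a b u * A a i u * partialD k (A b j) u) := by
  have h : ∀ a b, DifferentiableAt ℝ (fun v ↦ T a b v * A a i v * A b j v) u :=
    fun a b ↦ ((hT a b).fun_mul (hA a i)).fun_mul (hA b j)
  simp only [pullTwo, Fin.sum_univ_two]
  rw [partialD_add ((h 0 0).fun_add (h 0 1)) ((h 1 0).fun_add (h 1 1)),
    partialD_add (h 0 0) (h 0 1), partialD_add (h 1 0) (h 1 1)]
  simp only [partialD_mul ((hT _ _).fun_mul (hA _ i)) (hA _ j), partialD_mul (hT _ _) (hA _ i)]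
  ring

end Calculus

/-! ### Transition maps and tensoriality of the divergence -/

section Chart

theorem isOpen_transition_domain {M : Type*} [TopologicalSpace M]
    (z φ : OpenPartialHomeomorph M Plane) :
    IsOpen (φ.target ∩ φ.symm ⁻¹' z.source) :=
  φ.isOpen_inter_preimage_symm z.open_source

variable {M : Type*} [TopologicalSpace M] [ChartedSpace Plane M]
  {φ z : OpenPartialHomeomorph M Plane}

/-- The partial derivatives of the transition map from the chart `φ` to the chart `z`. -/
noncomputable def jacobian (z φ : OpenPartialHomeomorph M Plane) (a i : Fin 2) (u : Plane) : ℝ :=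
  partialD i (fun v ↦ z (φ.symm v) a) u

theorem contDiffAt_transition (hφ : φ ∈ IsManifold.maximalAtlas (𝓡 2) ∞ M)
    (hz : z ∈ IsManifold.maximalAtlas (𝓡 2) ∞ M) {u : Plane}
    (hu : u ∈ φ.target ∩ φ.symm ⁻¹' z.source) :
    ContDiffAt ℝ ∞ (fun v ↦ z (φ.symm v)) u :=
  (((contMDiffAt_of_mem_maximalAtlas hz hu.2).comp u
    (contMDiffAt_symm_of_mem_maximalAtlas hφ hu.1))).contDiffAt

theorem contDiffAt_transition_apply (hφ : φ ∈ IsManifold.maximalAtlas (𝓡 2) ∞ M)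
    (hz : z ∈ IsManifold.maximalAtlas (𝓡 2) ∞ M) {u : Plane}
    (hu : u ∈ φ.target ∩ φ.symm ⁻¹' z.source) (a : Fin 2) :
    ContDiffAt ℝ 2 (fun v ↦ z (φ.symm v) a) u :=
  ((EuclideanSpace.proj a : Plane →L[ℝ] ℝ).contDiff.contDiffAt.comp u
    (contDiffAt_transition hφ hz hu)).of_le (WithTop.coe_le_coe.2 le_top)

/-- The chain rule for `φ.symm = z.symm ∘ (z ∘ φ.symm)`, valid near `u`. -/
theorem coordVec_eq_sum (hφ : φ ∈ IsManifold.maximalAtlas (𝓡 2) ∞ M)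
    (hz : z ∈ IsManifold.maximalAtlas (𝓡 2) ∞ M) {u : Plane}
    (hu : u ∈ φ.target ∩ φ.symm ⁻¹' z.source) (i : Fin 2) :
    (id (coordVec φ i u) : Plane) =
      ∑ a, jacobian z φ a i u • (id (coordVec z a (z (φ.symm u))) : Plane) := by
  have hτ := (contDiffAt_transition hφ hz hu).differentiableAt (by simp)
  have h1 : MDifferentiableAt (𝓡 2) (𝓡 2) z.symm (z (φ.symm u)) :=
    (contMDiffAt_symm_of_mem_maximalAtlas hz (z.map_source hu.2)).mdifferentiableAt (by simp)
  have h2 : φ.symm =ᶠ[nhds u] z.symm ∘ fun v ↦ z (φ.symm v) := by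
    filter_upwards [(isOpen_transition_domain z φ).mem_nhds hu] with v hv
    exact (z.left_inv hv.2).symm
  have h3 : (mfderiv (𝓡 2) (𝓡 2) φ.symm u : Plane →L[ℝ] Plane) =
      (mfderiv (𝓡 2) (𝓡 2) z.symm (z (φ.symm u)) : Plane →L[ℝ] Plane).comp
        (fderiv ℝ (fun v ↦ z (φ.symm v)) u) := by
    have h4 := mfderiv_comp u h1 hτ.mdifferentiableAt
    rw [mfderiv_eq_fderiv] at h4
    exact h2.mfderiv_eq.trans h4
  have h5 : ∀ c, jacobian z φ c i u = fderiv ℝ (fun v ↦ z (φ.symm v)) u (stdVec i) c := fun c ↦ by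
    have := ((EuclideanSpace.proj c : Plane →L[ℝ] ℝ).hasFDerivAt.comp u hτ.hasFDerivAt).fderiv
    exact congrArg (fun L : Plane →L[ℝ] ℝ ↦ L (stdVec i)) this
  have h6 : (id (coordVec φ i u) : Plane) =
      (mfderiv (𝓡 2) (𝓡 2) z.symm (z (φ.symm u)) : Plane →L[ℝ] Plane)
        (fderiv ℝ (fun v ↦ z (φ.symm v)) u (stdVec i)) :=
    congrArg (fun L : Plane →L[ℝ] Plane ↦ L (stdVec i)) h3
  rw [h6, eq_sum_stdVec (fderiv ℝ (fun v ↦ z (φ.symm v)) u (stdVec i))]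
  simp only [← h5]
  have h7 : ∀ (L : Plane →L[ℝ] Plane) (c : Fin 2 → ℝ),
      L (∑ a, c a • stdVec a) = ∑ a, c a • L (stdVec a) := fun L c ↦ by simp
  exact h7 _ _

theorem comp_eq_pullTwo (S : TwoTensor M) (hφ : φ ∈ IsManifold.maximalAtlas (𝓡 2) ∞ M)
    (hz : z ∈ IsManifold.maximalAtlas (𝓡 2) ∞ M) {u : Plane}
    (hu : u ∈ φ.target ∩ φ.symm ⁻¹' z.source) (i j : Fin 2) :
    comp S φ i j u = pullTwo (fun a i ↦ jacobian z φ a i u)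
      (fun a b ↦ comp S z a b (z (φ.symm u))) i j := by
  -- The base points `φ.symm u` and `z.symm (z (φ.symm u))` are equal only propositionally; reading
  -- all tangent spaces as `Plane` allows the substitution.
  have h1 : ∀ (p q : M) (v w : Plane), p = q →
      (S p : Plane →L[ℝ] Plane →L[ℝ] ℝ) v w = (S q : Plane →L[ℝ] Plane →L[ℝ] ℝ) v w := by
    rintro p _ v w rfl
    rfl
  have h2 := bilin_eq_pullTwo (S (φ.symm u)) (coordVec_eq_sum hφ hz hu) i j
  refine h2.trans ?_
  congr 1
  funext a b
  exact h1 _ _ _ _ (z.left_inv hu.2).symm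

theorem differentiableAt_jacobian (hφ : φ ∈ IsManifold.maximalAtlas (𝓡 2) ∞ M)
    (hz : z ∈ IsManifold.maximalAtlas (𝓡 2) ∞ M) {u : Plane}
    (hu : u ∈ φ.target ∩ φ.symm ⁻¹' z.source) (a i : Fin 2) :
    DifferentiableAt ℝ (jacobian z φ a i) u :=
  differentiableAt_fderiv_apply (contDiffAt_transition_apply hφ hz hu a) (stdVec i)

theorem partialD_comp_eq_pullTwoDeriv {S : TwoTensor M}
    (hφ : φ ∈ IsManifold.maximalAtlas (𝓡 2) ∞ M)
    (hz : z ∈ IsManifold.maximalAtlas (𝓡 2) ∞ M) {u : Plane}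
    (hu : u ∈ φ.target ∩ φ.symm ⁻¹' z.source)
    (hS : ∀ a b, DifferentiableAt ℝ (comp S z a b) (z (φ.symm u))) (k i j : Fin 2) :
    partialD k (comp S φ i j) u = pullTwoDeriv (fun a i ↦ jacobian z φ a i u)
      (fun a k i ↦ partialD k (jacobian z φ a i) u) (fun a b ↦ comp S z a b (z (φ.symm u)))
      (fun c a b ↦ partialD c (comp S z a b) (z (φ.symm u))) k i j := by
  have hτ := (contDiffAt_transition hφ hz hu).differentiableAt (by simp)
  have h1 : comp S φ i j =ᶠ[nhds u] fun v ↦ pullTwo (fun a i ↦ jacobian z φ a i v)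
      (fun a b ↦ comp S z a b (z (φ.symm v))) i j := by
    filter_upwards [(isOpen_transition_domain z φ).mem_nhds hu] with v hv
    exact comp_eq_pullTwo S hφ hz hv i j
  have h2 : ∀ a b, DifferentiableAt ℝ (fun v ↦ comp S z a b (z (φ.symm v))) u := fun a b ↦
    (hS a b).fun_comp' u hτ
  rw [partialD_congr h1, partialD_pullTwo (A := jacobian z φ)
    (T := fun a b v ↦ comp S z a b (z (φ.symm v))) (differentiableAt_jacobian hφ hz hu) h2]
  simp only [partialD_comp (hS _ _) hτ]
  rfl

theorem comp_symm {S : TwoTensor M} (hS : IsSymmetricOn S φ.source) {u : Plane}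
    (hu : u ∈ φ.target) (i j : Fin 2) : comp S φ i j u = comp S φ j i u :=
  hS _ (φ.map_target hu) _ _

theorem partialD_comp_symm {S : TwoTensor M} (hS : IsSymmetricOn S φ.source) {u : Plane}
    (hu : u ∈ φ.target) (k i j : Fin 2) :
    partialD k (comp S φ i j) u = partialD k (comp S φ j i) u :=
  partialD_congr (by
    filter_upwards [φ.open_target.mem_nhds hu] with v hv using comp_symm hS hv i j) k

variable [IsManifold (𝓡 2) ∞ M]

theorem isSymmetricOn_metric (g : Metric M) (U : Set M) : IsSymmetricOn g.inner U :=
  fun p _ v w ↦ g.symm p v w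

theorem differentiableAt_metric_comp (g : Metric M) (hφ : φ ∈ IsManifold.maximalAtlas (𝓡 2) ∞ M)
    {u : Plane} (hu : u ∈ φ.target) (i j : Fin 2) :
    DifferentiableAt ℝ (comp g.inner φ i j) u :=
  ((contDiffOn_comp hφ (g.contMDiff.of_le (by simp)).contMDiffOn i j).differentiableOn
    (by simp)).differentiableAt (φ.open_target.mem_nhds hu)

/-- The components of the divergence transform like those of a one-form. -/
theorem divergence_eq_sum (g : Metric M) {S : TwoTensor M}
    (hφ : φ ∈ IsManifold.maximalAtlas (𝓡 2) ∞ M)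
    (hz : z ∈ IsManifold.maximalAtlas (𝓡 2) ∞ M) {u : Plane}
    (hu : u ∈ φ.target ∩ φ.symm ⁻¹' z.source)
    (hS : ∀ a b, DifferentiableAt ℝ (comp S z a b) (z (φ.symm u))) (j : Fin 2) :
    divergence g S φ j u = ∑ b, divergence g S z b (z (φ.symm u)) * jacobian z φ b j u := by
  have hw : z (φ.symm u) ∈ z.target := z.map_source hu.2
  have hinv' : ∀ c d, invMetric g z (z (φ.symm u)) c d =
      ∑ k, ∑ l, jacobian z φ c k u * invMetric g φ u k l * jacobian z φ d l u :=
    inv_apply_eq_of_pullTwo (fun i j ↦ comp_eq_pullTwo g.inner hφ hz hu i j)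
      (metric_comp_det_ne_zero g hφ hu.1)
  have hinv : ∀ d b, ∑ x, invMetric g z (z (φ.symm u)) d x * comp g.inner z x b (z (φ.symm u)) =
      if d = b then 1 else 0 := fun d b ↦ by
    have h := Matrix.nonsing_inv_mul (Matrix.of fun i j ↦ comp g.inner z i j (z (φ.symm u)))
      (isUnit_iff_ne_zero.2 (metric_comp_det_ne_zero g hz hw))
    have h' := congrFun (congrFun h d) b
    rwa [Matrix.mul_apply, Matrix.one_apply] at h'
  -- Here `h` is the array of second derivatives of the transition map, symmetric by Schwarz's
  -- theorem.
  have hΓ := christoffelAt_pull (A := fun a i ↦ jacobian z φ a i u)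
    (h := fun a k i ↦ partialD k (jacobian z φ a i) u)
    (G := fun a b ↦ comp g.inner z a b (z (φ.symm u)))
    (dg := fun c a b ↦ partialD c (comp g.inner z a b) (z (φ.symm u)))
    (fun a i j ↦ fderiv_fderiv_comm (contDiffAt_transition_apply hφ hz hu a) _ _)
    (comp_symm (isSymmetricOn_metric g _) hw)
    (partialD_comp_symm (isSymmetricOn_metric g _) hw) hinv hinv'
  have hg := partialD_comp_eq_pullTwoDeriv hφ hz hu
    (fun a b ↦ differentiableAt_metric_comp g hz hw a b)
  have hcov := covDerivAt_pull hΓ (fun a b ↦ comp S z a b (z (φ.symm u)))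
    (fun c a b ↦ partialD c (comp S z a b) (z (φ.symm u)))
  refine divergenceAt_pull hinv' (C' := fun k i j ↦ covDeriv g S φ k i j u)
    (C := fun k i j ↦ covDeriv g S z k i j (z (φ.symm u))) (fun k i j ↦ ?_) j
  refine Eq.trans ?_ (hcov k i j)
  simp only [covDeriv, christoffel, hg, comp_eq_pullTwo S hφ hz hu,
    partialD_comp_eq_pullTwoDeriv hφ hz hu hS]
  rfl

end Chart

/-! ### The Cauchy-Riemann equations -/

/-- The real-linear identification of the complex numbers with the plane. -/
noncomputable def ofComplexCLM : ℂ →L[ℝ] Plane :=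
  LinearMap.toContinuousLinearMap
    { toFun := ofComplex
      map_add' := fun a b ↦ by ext i; fin_cases i <;> simp [ofComplex]
      map_smul' := fun c a ↦ by ext i; fin_cases i <;> simp [ofComplex] }

theorem ofComplexCLM_apply (ζ : ℂ) : ofComplexCLM ζ = ofComplex ζ := rfl

theorem ofComplex_one : ofComplex 1 = stdVec 0 := by
  ext i; fin_cases i <;> simp [ofComplex, stdVec]

theorem ofComplex_I : ofComplex Complex.I = stdVec 1 := by
  ext i; fin_cases i <;> simp [ofComplex, stdVec]

theorem ofComplex_surjective (u : Plane) : ∃ ζ, ofComplex ζ = u :=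
  ⟨⟨u 0, u 1⟩, by ext i; fin_cases i <;> simp [ofComplex]⟩

/-- A real derivative `L` is complex-linear exactly when `L I = I * L 1`, and `1`, `I` correspond to
the two coordinate directions. -/
theorem differentiableAt_complex_iff_partialD {P Q : Plane → ℝ} {ζ : ℂ}
    (hP : DifferentiableAt ℝ P (ofComplex ζ)) (hQ : DifferentiableAt ℝ Q (ofComplex ζ)) :
    DifferentiableAt ℂ (fun ζ ↦ (P (ofComplex ζ) : ℂ) + (Q (ofComplex ζ) : ℂ) * Complex.I) ζ ↔
      partialD 0 P (ofComplex ζ) = partialD 1 Q (ofComplex ζ) ∧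
        partialD 1 P (ofComplex ζ) = -partialD 0 Q (ofComplex ζ) := by
  have h1 : ∀ {R : Plane → ℝ}, DifferentiableAt ℝ R (ofComplex ζ) →
      HasFDerivAt (fun ζ ↦ (R (ofComplex ζ) : ℂ))
        (Complex.ofRealCLM.comp ((fderiv ℝ R (ofComplex ζ)).comp ofComplexCLM)) ζ := fun hR ↦
    Complex.ofRealCLM.hasFDerivAt.comp ζ
      (HasFDerivAt.comp ζ (g := _) (f := ofComplex) hR.hasFDerivAt ofComplexCLM.hasFDerivAt)
  have h2 := (h1 hP).fun_add ((h1 hQ).mul_const' Complex.I)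
  rw [differentiableAt_complex_iff_differentiableAt_real, h2.fderiv]
  simp only [h2.differentiableAt, true_and, add_apply, smul_apply, ContinuousLinearMap.comp_apply,
    ofComplexCLM_apply, ofComplex_one, ofComplex_I, Complex.ofRealCLM_apply, Complex.ext_iff]
  simp only [partialD]
  simp
  constructor
  · rintro ⟨h, h'⟩
    exact ⟨h'.symm, h⟩
  · rintro ⟨h, h'⟩
    exact ⟨h', h.symm⟩

/-! ### Isothermal coordinates: divergence and the `(2,0)` part -/

section Isothermal

variable {M : Type*} [TopologicalSpace M] [ChartedSpace Plane M]

theorem twoZeroCoeff_eq (S : TwoTensor M) (z : OpenPartialHomeomorph M Plane) (ζ : ℂ) :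
    twoZeroCoeff S z ζ =
      (((1 / 4) * (comp S z 0 0 (ofComplex ζ) - comp S z 1 1 (ofComplex ζ)) : ℝ) : ℂ) +
        ((-(1 / 4) * (comp S z 0 1 (ofComplex ζ) + comp S z 1 0 (ofComplex ζ)) : ℝ) : ℂ) *
          Complex.I := by
  have h : ∀ (B : Plane →L[ℝ] Plane →L[ℝ] ℝ) (v w : Plane),
      ((B ((1 / 2 : ℝ) • v) ((1 / 2 : ℝ) • v) - B (-((1 / 2 : ℝ) • w)) (-((1 / 2 : ℝ) • w)) : ℝ) : ℂ)
        + ((B ((1 / 2 : ℝ) • v) (-((1 / 2 : ℝ) • w)) + B (-((1 / 2 : ℝ) • w)) ((1 / 2 : ℝ) • v) : ℝ) :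
          ℂ) * Complex.I =
      (((1 / 4) * (B v v - B w w) : ℝ) : ℂ) + ((-(1 / 4) * (B v w + B w v) : ℝ) : ℂ) *
        Complex.I := by
    intro B v w
    simp only [map_neg, map_smul, neg_apply, smul_apply, smul_eq_mul]
    congr 3
    · ring
    · ring
  exact h _ _ _

variable [IsManifold (𝓡 2) ∞ M] {g : Metric M} {o : OrientedAtlas M}
  {z : OpenPartialHomeomorph M Plane}

theorem IsIsothermal.comp_pos (hz : IsIsothermal g o z) {u : Plane} (hu : u ∈ z.target) :
    0 < comp g.inner z 0 0 u :=
  g.pos _ _ ((linearIndependent_coordVec hz.smooth hu).ne_zero 0)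

theorem IsIsothermal.offDiag' (hz : IsIsothermal g o z) {u : Plane} (hu : u ∈ z.target) :
    comp g.inner z 1 0 u = 0 :=
  (comp_symm (isSymmetricOn_metric g _) hu 1 0).trans (hz.offDiag u hu)

theorem IsIsothermal.invMetric_eq (hz : IsIsothermal g o z) {u : Plane} (hu : u ∈ z.target) :
    invMetric g z u = Matrix.of fun i j ↦ if i = j then (comp g.inner z 0 0 u)⁻¹ else 0 := by
  have h0 := (hz.comp_pos hu).ne'
  refine Matrix.inv_eq_left_inv ?_
  ext i j
  fin_cases i <;> fin_cases j <;>
    simp [Matrix.mul_apply, hz.offDiag u hu, hz.offDiag' hu, ← hz.diag u hu, h0]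

theorem IsIsothermal.comp_add_comp_eq_zero (hz : IsIsothermal g o z) {S : TwoTensor M}
    (hS : IsTraceFreeOn g S z.source) {u : Plane} (hu : u ∈ z.target) :
    comp S z 0 0 u + comp S z 1 1 u = 0 := by
  have h := hS _ (z.map_target hu)
  rw [trace_eq_comp g S hz.smooth hu, hz.invMetric_eq hu] at h
  simp only [Fin.sum_univ_two, Matrix.of_apply] at h
  simp only [Fin.isValue, ↓reduceIte, zero_ne_one, one_ne_zero, zero_mul, add_zero, zero_add,
    ← mul_add] at h
  exact (mul_eq_zero.1 h).resolve_left (inv_ne_zero (hz.comp_pos hu).ne')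

/-- In an isothermal coordinate the divergence of a symmetric trace-free tensor is the Euclidean one,
up to the conformal factor. -/
theorem IsIsothermal.divergence_eq (hz : IsIsothermal g o z) {S : TwoTensor M}
    (hsymm : IsSymmetricOn S z.source) (htr : IsTraceFreeOn g S z.source) {u : Plane}
    (hu : u ∈ z.target) (j : Fin 2) :
    divergence g S z j u = (comp g.inner z 0 0 u)⁻¹ * ∑ k, partialD k (comp S z k j) u := by
  have h0 := (hz.comp_pos hu).ne'
  have hn := z.open_target.mem_nhds hu
  have e01 : ∀ k, partialD k (comp g.inner z 0 1) u = 0 := fun k ↦ by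
    have h : comp g.inner z 0 1 =ᶠ[nhds u] fun _ ↦ 0 := by
      filter_upwards [hn] with v hv using hz.offDiag v hv
    rw [partialD_congr h, partialD, fderiv_const_apply, zero_apply]
  have e10 : ∀ k, partialD k (comp g.inner z 1 0) u = 0 := fun k ↦
    (partialD_comp_symm (isSymmetricOn_metric g _) hu k 1 0).trans (e01 k)
  have e11 : ∀ k, partialD k (comp g.inner z 1 1) u = partialD k (comp g.inner z 0 0) u :=
    fun k ↦ partialD_congr (by
      filter_upwards [hn] with v hv using (hz.diag v hv).symm) k
  have s10 : comp S z 1 0 u = comp S z 0 1 u := comp_symm hsymm hu 1 0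
  have s11 : comp S z 1 1 u = -comp S z 0 0 u := by
    linear_combination hz.comp_add_comp_eq_zero htr hu
  -- With `λ = g_{00}` and `a = d(log λ) / 2` one has `Γ^l_{kj} = δ_{lk} a_j + δ_{lj} a_k - δ_{kj}
  -- a_l`. Then `∑_k Γ^l_{kk} = 0` because the dimension is two, and `∑ Γ^l_{kj} S_{kl} = a_j
  -- (S_{00} + S_{11}) = 0` because `S` is symmetric and trace-free.
  simp only [divergence, covDeriv, christoffel, hz.invMetric_eq hu, Matrix.of_apply,
    Fin.sum_univ_two]
  fin_cases j <;>
  · simp [e01, e10, e11, s10, s11]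
    ring

/-- Since the divergence transforms as a one-form, its vanishing needs checking in the chart `z`
only. -/
theorem IsIsothermal.isDivergenceFreeOn_iff (hz : IsIsothermal g o z) {S : TwoTensor M}
    (hS : ∀ i j, ∀ u ∈ z.target, DifferentiableAt ℝ (comp S z i j) u) :
    IsDivergenceFreeOn g S z.source ↔ ∀ u ∈ z.target, ∀ j, divergence g S z j u = 0 := by
  constructor
  · intro h u hu j
    have h1 := h z hz.smooth (z.symm u) ⟨z.map_target hu, z.map_target hu⟩ j
    rwa [z.right_inv hu] at h1
  · rintro h φ hφ p ⟨hp, hpz⟩ j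
    have hu : φ p ∈ φ.target ∩ φ.symm ⁻¹' z.source :=
      ⟨φ.map_source hp, by rwa [Set.mem_preimage, φ.left_inv hp]⟩
    have hw := z.map_source hu.2
    rw [divergence_eq_sum g hφ hz.smooth hu (fun a b ↦ hS a b _ hw)]
    simp [h _ hw]

/-- A symmetric trace-free tensor field with differentiable components is divergence-free if and
only if its `(2,0)` part is holomorphic. -/
theorem IsIsothermal.isDivergenceFreeOn_iff_isHolomorphicIn (hz : IsIsothermal g o z)
    {S : TwoTensor M} (hS : ∀ i j, ∀ u ∈ z.target, DifferentiableAt ℝ (comp S z i j) u)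
    (hsymm : IsSymmetricOn S z.source) (htr : IsTraceFreeOn g S z.source) :
    IsDivergenceFreeOn g S z.source ↔ IsHolomorphicIn S z := by
  have hopen : IsOpen (ofComplex ⁻¹' z.target) :=
    z.open_target.preimage ofComplexCLM.continuous
  have hiff : ∀ ζ, ofComplex ζ ∈ z.target → (DifferentiableAt ℂ (twoZeroCoeff S z) ζ ↔
      ∀ j, divergence g S z j (ofComplex ζ) = 0) := by
    intro ζ hu
    have hn := z.open_target.mem_nhds hu
    have hl := inv_ne_zero (hz.comp_pos hu).ne'
    have hq : twoZeroCoeff S z = fun ζ ↦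
        (((fun u ↦ (1 / 4) * (comp S z 0 0 u - comp S z 1 1 u)) (ofComplex ζ) : ℝ) : ℂ) +
        (((fun u ↦ -(1 / 4) * (comp S z 0 1 u + comp S z 1 0 u)) (ofComplex ζ) : ℝ) : ℂ) *
          Complex.I := funext fun ζ ↦ twoZeroCoeff_eq S z ζ
    have d := fun i j ↦ hS i j _ hu
    rw [hq, differentiableAt_complex_iff_partialD (((d 0 0).fun_sub (d 1 1)).const_mul _)
      (((d 0 1).fun_add (d 1 0)).const_mul _)]
    have cm : ∀ (c : ℝ) {f : Plane → ℝ}, DifferentiableAt ℝ f (ofComplex ζ) → ∀ k,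
        partialD k (fun u ↦ c * f u) (ofComplex ζ) = c * partialD k f (ofComplex ζ) := by
      intro c f hf k
      rw [partialD, fderiv_const_mul hf]
      simp [partialD]
    have s11 : ∀ k, partialD k (comp S z 1 1) (ofComplex ζ) =
        -partialD k (comp S z 0 0) (ofComplex ζ) := fun k ↦ by
      have h : comp S z 1 1 =ᶠ[nhds (ofComplex ζ)] fun u ↦ (-1) * comp S z 0 0 u := by
        filter_upwards [hn] with v hv
        linear_combination hz.comp_add_comp_eq_zero htr hv
      rw [partialD_congr h, cm _ (d 0 0), neg_one_mul]
    have s10 : ∀ k, partialD k (comp S z 1 0) (ofComplex ζ) =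
        partialD k (comp S z 0 1) (ofComplex ζ) := fun k ↦ partialD_comp_symm hsymm hu k 1 0
    -- The Cauchy-Riemann equations become `∂_0 S_{00} = -∂_1 S_{01}` and `∂_1 S_{00} = ∂_0 S_{01}`:
    -- the divergence components `j = 0` and `j = 1`, the latter after substituting `S_{11} =
    -- -S_{00}`.
    simp only [cm _ ((d 0 0).fun_sub (d 1 1)), cm _ ((d 0 1).fun_add (d 1 0)),
      partialD_sub (d 0 0) (d 1 1), partialD_add (d 0 1) (d 1 0), s11, s10,
      hz.divergence_eq hsymm htr hu, mul_eq_zero, hl, false_or, Fin.forall_fin_two,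
      Fin.sum_univ_two]
    constructor <;> rintro ⟨h, h'⟩ <;> constructor <;> linarith
  rw [hz.isDivergenceFreeOn_iff hS, IsHolomorphicIn]
  constructor
  · intro h ζ hζ
    exact ((hiff ζ hζ).2 (h _ hζ)).differentiableWithinAt
  · intro h u hu
    obtain ⟨ζ, rfl⟩ := ofComplex_surjective u
    exact (hiff ζ hu).1 (h.differentiableAt (hopen.mem_nhds hu))

end Isothermal

/-! ### The Codazzi equation -/

section Patch

open Topology

theorem partialD_inner {a b : Plane → Space} {u : Plane} (ha : DifferentiableAt ℝ a u)
    (hb : DifferentiableAt ℝ b u) (k : Fin 2) :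
    partialD k (fun v ↦ inner ℝ (a v) (b v)) u =
      inner ℝ (a u) (fderiv ℝ b u (stdVec k)) + inner ℝ (fderiv ℝ a u (stdVec k)) (b u) := by
  rw [partialD, fderiv_inner_apply ℝ ha hb]

theorem partialD_eq_zero_of_eventually_const {f : Plane → ℝ} {u : Plane} {c : ℝ}
    (h : ∀ᶠ v in 𝓝 u, f v = c) (k : Fin 2) : partialD k f u = 0 := by
  have h' : f =ᶠ[𝓝 u] fun _ ↦ c := h
  rw [partialD_congr h', partialD, fderiv_const_apply, zero_apply]

/-- The components of the metric induced by a parametrization. -/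
noncomputable def gram (f : Plane → Space) (i j : Fin 2) (v : Plane) : ℝ :=
  inner ℝ (fderiv ℝ f v (stdVec i)) (fderiv ℝ f v (stdVec j))

/-- The components of the second fundamental form of a parametrization `f` with normal `ν`. -/
noncomputable def sff (f ν : Plane → Space) (i j : Fin 2) (v : Plane) : ℝ :=
  -inner ℝ (fderiv ℝ ν v (stdVec i)) (fderiv ℝ f v (stdVec j))

variable {f ν : Plane → Space} {u : Plane}

theorem differentiableAt_sff (hf : ContDiffAt ℝ 2 f u) (hν : ContDiffAt ℝ 2 ν u) (i j : Fin 2) :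
    DifferentiableAt ℝ (sff f ν i j) u :=
  ((differentiableAt_fderiv_apply hν _).inner ℝ (differentiableAt_fderiv_apply hf _)).fun_neg

/-- Differentiating `⟨∂_j f, ν⟩ = 0` gives `II_{ij} = ⟨∂_i ∂_j f, ν⟩`, which is symmetric by
Schwarz's theorem. -/
theorem sff_symm (hf : ContDiffAt ℝ 2 f u) (hν : ContDiffAt ℝ 2 ν u)
    (hn : ∀ᶠ v in 𝓝 u, ∀ i, inner ℝ (fderiv ℝ f v (stdVec i)) (ν v) = 0) (i j : Fin 2) :
    sff f ν i j u = sff f ν j i u := by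
  have h : ∀ i j, sff f ν i j u =
      inner ℝ (fderiv ℝ (fun v ↦ fderiv ℝ f v (stdVec j)) u (stdVec i)) (ν u) := by
    intro i j
    have h1 := partialD_eq_zero_of_eventually_const (hn.mono fun v hv ↦ hv j) i
    rw [partialD_inner (differentiableAt_fderiv_apply hf _) (hν.differentiableAt (by simp))] at h1
    rw [sff, real_inner_comm]
    linarith
  rw [h, h, fderiv_fderiv_comm hf]

/-- Derivatives of a unit normal are tangential, so the tangential Gauss formula may be paired with
them. -/
theorem inner_fderiv_normal (hν : DifferentiableAt ℝ ν u) (h1 : ∀ᶠ v in 𝓝 u, ‖ν v‖ = 1)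
    (k : Fin 2) : inner ℝ (fderiv ℝ ν u (stdVec k)) (ν u) = 0 := by
  have h : ∀ᶠ v in 𝓝 u, inner ℝ (ν v) (ν v) = (1 : ℝ) := h1.mono fun v hv ↦ by
    rw [real_inner_self_eq_norm_sq, hv, one_pow]
  have h2 := partialD_eq_zero_of_eventually_const h k
  rw [partialD_inner hν hν, real_inner_comm] at h2
  linarith

/-- A vector of Euclidean three-space orthogonal to `n` is a combination of any two linearly
independent vectors orthogonal to `n`. -/
theorem exists_eq_sum_smul_of_inner_eq_zero {a : Fin 2 → Space} {n w : Space}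
    (ha : LinearIndependent ℝ a) (hn : n ≠ 0) (han : ∀ i, inner ℝ (a i) n = 0)
    (hw : inner ℝ w n = 0) : ∃ c : Fin 2 → ℝ, w = ∑ i, c i • a i := by
  have hle : Submodule.span ℝ (Set.range a) ≤ (Submodule.span ℝ {n})ᗮ := by
    rw [Submodule.span_le]
    rintro _ ⟨i, rfl⟩
    exact Submodule.mem_orthogonal_singleton_iff_inner_left.2 (han i)
  have h1 : Module.finrank ℝ (Submodule.span ℝ (Set.range a)) = 2 := by
    simpa using finrank_span_eq_card ha
  have h2 : Module.finrank ℝ (Submodule.span ℝ {n})ᗮ = 2 := by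
    have : Fact (Module.finrank ℝ Space = 2 + 1) := ⟨by simp⟩
    exact Submodule.finrank_orthogonal_span_singleton hn
  have hw' : w ∈ Submodule.span ℝ (Set.range a) := by
    rw [Submodule.eq_of_le_of_finrank_eq hle (h1.trans h2.symm)]
    exact Submodule.mem_orthogonal_singleton_iff_inner_left.2 hw
  obtain ⟨c, hc⟩ := (Submodule.mem_span_range_iff_exists_fun ℝ).1 hw'
  exact ⟨c, hc.symm⟩

theorem partialD_gram (hf : ContDiffAt ℝ 2 f u) (k i j : Fin 2) :
    partialD k (gram f i j) u =
      inner ℝ (fderiv ℝ f u (stdVec i))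
        (fderiv ℝ (fun v ↦ fderiv ℝ f v (stdVec j)) u (stdVec k)) +
      inner ℝ (fderiv ℝ f u (stdVec j))
        (fderiv ℝ (fun v ↦ fderiv ℝ f v (stdVec i)) u (stdVec k)) := by
  have h := partialD_inner (differentiableAt_fderiv_apply hf (stdVec i))
    (differentiableAt_fderiv_apply hf (stdVec j)) k
  rw [real_inner_comm (fderiv ℝ f u (stdVec j))] at h
  exact h

/-- The tangential part of the Gauss formula: the tangential components of the second derivatives of
a parametrization are the Christoffel symbols. -/
theorem inner_snd_fderiv_eq_christoffelAt (hf : ContDiffAt ℝ 2 f u) {w : Space}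
    {Ginv : Fin 2 → Fin 2 → ℝ}
    (hinv : ∀ d b, ∑ x, Ginv d x * gram f x b u = if d = b then 1 else 0)
    (ha : LinearIndependent ℝ fun i ↦ fderiv ℝ f u (stdVec i)) (hν : ν u ≠ 0)
    (hn : ∀ i, inner ℝ (fderiv ℝ f u (stdVec i)) (ν u) = 0) (hw : inner ℝ w (ν u) = 0)
    (hsymm : ∀ i j, Ginv i j = Ginv j i) (i j : Fin 2) :
    inner ℝ w (fderiv ℝ (fun v ↦ fderiv ℝ f v (stdVec j)) u (stdVec i)) =
      ∑ l, christoffelAt Ginv (fun k i j ↦ partialD k (gram f i j) u) l i j *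
        inner ℝ w (fderiv ℝ f u (stdVec l)) := by
  -- Christoffel symbols of the first kind: expanding `∂_k g_{ij}` by the product rule, all but the
  -- terms `⟨∂_l f, ∂_i ∂_j f⟩` cancel.
  have hlow : ∀ l, (1 / 2 : ℝ) * (partialD i (gram f j l) u + partialD j (gram f i l) u
      - partialD l (gram f i j) u) =
      inner ℝ (fderiv ℝ f u (stdVec l))
        (fderiv ℝ (fun v ↦ fderiv ℝ f v (stdVec j)) u (stdVec i)) := by
    intro l
    simp only [partialD_gram hf]
    rw [fderiv_fderiv_comm hf (stdVec l) (stdVec i), fderiv_fderiv_comm hf (stdVec l) (stdVec j),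
      fderiv_fderiv_comm hf (stdVec i) (stdVec j)]
    ring
  have hΓ : ∀ l, christoffelAt Ginv (fun k i j ↦ partialD k (gram f i j) u) l i j =
      ∑ s, Ginv l s * inner ℝ (fderiv ℝ f u (stdVec s))
        (fderiv ℝ (fun v ↦ fderiv ℝ f v (stdVec j)) u (stdVec i)) := by
    intro l
    simp only [christoffelAt, ← hlow, Fin.sum_univ_two]
    ring
  -- Expanding the tangential vector `w` in the frame `∂_m f`, the coefficient of `c m * ⟨∂_s f, X⟩`
  -- on the right is an entry of the inverse Gram matrix times the Gram matrix, that is, `δ_{sm}`.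
  obtain ⟨c, rfl⟩ := exists_eq_sum_smul_of_inner_eq_zero ha hν hn hw
  generalize hX : fderiv ℝ (fun v ↦ fderiv ℝ f v (stdVec j)) u (stdVec i) = X at hΓ
  simp only [hΓ]
  have hc : ∀ l, inner ℝ (∑ m, c m • fderiv ℝ f u (stdVec m)) (fderiv ℝ f u (stdVec l)) =
      ∑ m, c m * gram f m l u := fun l ↦ by
    simp [gram, Fin.sum_univ_two, inner_add_left, inner_smul_left]
  have hc' : inner ℝ (∑ m, c m • fderiv ℝ f u (stdVec m)) X =
      ∑ m, c m * inner ℝ (fderiv ℝ f u (stdVec m)) X := by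
    simp [Fin.sum_univ_two, inner_add_left, inner_smul_left]
  have hg : gram f 1 0 u = gram f 0 1 u := real_inner_comm _ _
  simp only [hc, hc']
  simp only [Fin.sum_univ_two] at hinv ⊢
  rw [hg, hsymm 1 0]
  have h00 := hinv 0 0
  have h01 := hinv 0 1
  have h10 := hinv 1 0
  have h11 := hinv 1 1
  rw [hsymm 1 0] at h10 h11
  simp only [hg, ↓reduceIte, zero_ne_one, one_ne_zero] at h00 h01 h10 h11
  linear_combination
    (-(c 0 * inner ℝ (fderiv ℝ f u (stdVec 0)) X)) * h00
    - (c 1 * inner ℝ (fderiv ℝ f u (stdVec 0)) X) * h01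
    - (c 0 * inner ℝ (fderiv ℝ f u (stdVec 1)) X) * h10
    - (c 1 * inner ℝ (fderiv ℝ f u (stdVec 1)) X) * h11

/-- The Codazzi equation. -/
theorem covDerivAt_sff_comm (hf : ContDiffAt ℝ 2 f u) (hν : ContDiffAt ℝ 2 ν u)
    {Ginv : Fin 2 → Fin 2 → ℝ}
    (hinv : ∀ d b, ∑ x, Ginv d x * gram f x b u = if d = b then 1 else 0)
    (hsymm : ∀ i j, Ginv i j = Ginv j i)
    (ha : LinearIndependent ℝ fun i ↦ fderiv ℝ f u (stdVec i))
    (h1 : ∀ᶠ v in 𝓝 u, ‖ν v‖ = 1)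
    (hn : ∀ᶠ v in 𝓝 u, ∀ i, inner ℝ (fderiv ℝ f v (stdVec i)) (ν v) = 0) (k i j : Fin 2) :
    covDerivAt (christoffelAt Ginv fun k i j ↦ partialD k (gram f i j) u)
        (fun i j ↦ sff f ν i j u) (fun k i j ↦ partialD k (sff f ν i j) u) k i j =
      covDerivAt (christoffelAt Ginv fun k i j ↦ partialD k (gram f i j) u)
        (fun i j ↦ sff f ν i j u) (fun k i j ↦ partialD k (sff f ν i j) u) i k j := by
  have hν0 : ν u ≠ 0 := fun h ↦ by simpa [h] using h1.self_of_nhds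
  have hgauss : ∀ i k j, inner ℝ (fderiv ℝ ν u (stdVec i))
      (fderiv ℝ (fun v ↦ fderiv ℝ f v (stdVec j)) u (stdVec k)) =
      -∑ l, christoffelAt Ginv (fun k i j ↦ partialD k (gram f i j) u) l k j * sff f ν i l u := by
    intro i k j
    rw [inner_snd_fderiv_eq_christoffelAt hf hinv ha hν0 hn.self_of_nhds
      (inner_fderiv_normal (hν.differentiableAt (by simp)) h1 i) hsymm k j]
    simp [sff]
  have hd : ∀ k i j, partialD k (sff f ν i j) u =
      -inner ℝ (fderiv ℝ ν u (stdVec i))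
        (fderiv ℝ (fun v ↦ fderiv ℝ f v (stdVec j)) u (stdVec k))
      - inner ℝ (fderiv ℝ (fun v ↦ fderiv ℝ ν v (stdVec i)) u (stdVec k))
        (fderiv ℝ f u (stdVec j)) := by
    intro k i j
    have h := partialD_inner (differentiableAt_fderiv_apply hν (stdVec i))
      (differentiableAt_fderiv_apply hf (stdVec j)) k
    have h' : partialD k (sff f ν i j) u = -partialD k (fun v ↦
        inner ℝ (fderiv ℝ ν v (stdVec i)) (fderiv ℝ f v (stdVec j))) u := by
      rw [partialD, partialD]
      have : sff f ν i j = fun v ↦ -inner ℝ (fderiv ℝ ν v (stdVec i)) (fderiv ℝ f v (stdVec j)) :=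
        rfl
      rw [this, fderiv_fun_neg, neg_apply]
    rw [h', h]
    ring
  have hΓ : ∀ l, christoffelAt Ginv (fun k i j ↦ partialD k (gram f i j) u) l k i =
      christoffelAt Ginv (fun k i j ↦ partialD k (gram f i j) u) l i k := by
    intro l
    have hg : gram f k i = gram f i k := funext fun v ↦ real_inner_comm _ _
    simp only [christoffelAt, hg, add_comm]
  -- By the Gauss formula the term `⟨∂_i ν, ∂_k ∂_j f⟩` of `∂_k II_{ij}` cancels `∑ Γ^l_{kj}
  -- II_{il}`. What remains, `-⟨∂_k ∂_i ν, ∂_j f⟩ - ∑ Γ^l_{ki} II_{lj}`, is symmetric in `k` and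
  -- `i`.
  simp only [covDerivAt, hd, hgauss, hΓ, fderiv_fderiv_comm hν (stdVec i) (stdVec k)]
  ring

end Patch

/-! ### Trace-free Codazzi tensors -/

/-- Contraction with the inverse metric commutes with covariant differentiation: if a symmetric
two-tensor is trace-free to first order at a point, then so is its covariant derivative. -/
theorem contract_covDerivAt_eq_zero {G S : Fin 2 → Fin 2 → ℝ} {dg dS : Fin 2 → Fin 2 → Fin 2 → ℝ}
    (hdg : ∀ k, dg k 1 0 = dg k 0 1) (hS : S 1 0 = S 0 1)
    (hdS : ∀ k, dS k 1 0 = dS k 0 1) (hdet : G 0 0 * G 1 1 - G 0 1 * G 0 1 ≠ 0)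
    (htr : G 1 1 * S 0 0 - 2 * (G 0 1 * S 0 1) + G 0 0 * S 1 1 = 0) (j : Fin 2)
    (hdtr : dg j 1 1 * S 0 0 + G 1 1 * dS j 0 0 - 2 * (dg j 0 1 * S 0 1 + G 0 1 * dS j 0 1)
      + (dg j 0 0 * S 1 1 + G 0 0 * dS j 1 1) = 0) {Ginv : Fin 2 → Fin 2 → ℝ}
    (h00 : Ginv 0 0 = G 1 1 / (G 0 0 * G 1 1 - G 0 1 * G 0 1))
    (h01 : Ginv 0 1 = -G 0 1 / (G 0 0 * G 1 1 - G 0 1 * G 0 1))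
    (h10 : Ginv 1 0 = -G 0 1 / (G 0 0 * G 1 1 - G 0 1 * G 0 1))
    (h11 : Ginv 1 1 = G 0 0 / (G 0 0 * G 1 1 - G 0 1 * G 0 1)) :
    ∑ k, ∑ i, Ginv k i * covDerivAt (christoffelAt Ginv dg) S dS j k i = 0 := by
  -- The trace is `T / Δ`, with `T` the left side of `htr` and `Δ` the Gram determinant. The right
  -- side is the quotient rule for `∂_j (T / Δ)`, and both `T` and its derivative vanish.
  have key : ∑ k, ∑ i, Ginv k i * covDerivAt (christoffelAt Ginv dg) S dS j k i =
      (dg j 1 1 * S 0 0 + G 1 1 * dS j 0 0 - 2 * (dg j 0 1 * S 0 1 + G 0 1 * dS j 0 1)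
        + (dg j 0 0 * S 1 1 + G 0 0 * dS j 1 1)) / (G 0 0 * G 1 1 - G 0 1 * G 0 1)
      - (G 1 1 * S 0 0 - 2 * (G 0 1 * S 0 1) + G 0 0 * S 1 1) *
        (dg j 0 0 * G 1 1 + G 0 0 * dg j 1 1 - 2 * (G 0 1 * dg j 0 1)) /
          (G 0 0 * G 1 1 - G 0 1 * G 0 1) ^ 2 := by
    simp only [covDerivAt, christoffelAt, Fin.sum_univ_two, h00, h01, h10, h11, hS]
    clear h00 h01 h10 h11
    generalize hΔ : G 0 0 * G 1 1 - G 0 1 * G 0 1 = Δ at hdet ⊢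
    fin_cases j <;>
    · simp only [Fin.zero_eta, Fin.mk_one, hdg, hdS]
      field_simp
      rw [← hΔ]
      ring
  rw [key, htr, hdtr]
  simp

/-! ### Isometric immersions with the same mean curvature -/

section Immersion

theorem eventually_mem_target {M : Type*} [TopologicalSpace M]
    {φ : OpenPartialHomeomorph M Plane} {u : Plane} (hu : u ∈ φ.target) : ∀ᶠ v in nhds u, v ∈ φ.target :=
  φ.open_target.mem_nhds hu

variable {M : Type*} [TopologicalSpace M] [ChartedSpace Plane M]
  {φ : OpenPartialHomeomorph M Plane} {F N F₁ F₂ N₁ N₂ : M → Space} {u : Plane}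

theorem contDiffAt_comp_symm (hF : ContMDiff (𝓡 2) (𝓡 3) ∞ F)
    (hφ : φ ∈ IsManifold.maximalAtlas (𝓡 2) ∞ M) (hu : u ∈ φ.target) :
    ContDiffAt ℝ 2 (fun v ↦ F (φ.symm v)) u :=
  (hF.contMDiffAt.comp u (contMDiffAt_symm_of_mem_maximalAtlas hφ hu)).contDiffAt.of_le
    (WithTop.coe_le_coe.2 le_top)

theorem mfderiv_coordVec (hF : ContMDiff (𝓡 2) (𝓡 3) ∞ F)
    (hφ : φ ∈ IsManifold.maximalAtlas (𝓡 2) ∞ M) (hu : u ∈ φ.target) (i : Fin 2) :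
    (mfderiv (𝓡 2) (𝓡 3) F (φ.symm u) (coordVec φ i u) : Space) =
      fderiv ℝ (fun v ↦ F (φ.symm v)) u (stdVec i) := by
  have h1 := mfderiv_comp u (hF.mdifferentiableAt (x := φ.symm u) (by simp))
    ((contMDiffAt_symm_of_mem_maximalAtlas hφ hu).mdifferentiableAt (by simp))
  have h2 : (mfderiv (𝓡 2) (𝓡 3) (F ∘ φ.symm) u : Plane →L[ℝ] Space) =
      fderiv ℝ (fun v ↦ F (φ.symm v)) u := mfderiv_eq_fderiv
  rw [← h2, h1]
  rfl

theorem comp_secondFundamentalForm (hF : ContMDiff (𝓡 2) (𝓡 3) ∞ F)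
    (hN : ContMDiff (𝓡 2) (𝓡 3) ∞ N) (hφ : φ ∈ IsManifold.maximalAtlas (𝓡 2) ∞ M)
    (hu : u ∈ φ.target) (i j : Fin 2) :
    comp (secondFundamentalForm F N) φ i j u =
      sff (fun v ↦ F (φ.symm v)) (fun v ↦ N (φ.symm v)) i j u := by
  rw [sff, ← mfderiv_coordVec hF hφ hu, ← mfderiv_coordVec hN hφ hu]
  rfl

theorem IsUnitNormalField.inner_eq_zero (hN : IsUnitNormalField F N)
    (hF : ContMDiff (𝓡 2) (𝓡 3) ∞ F) (hφ : φ ∈ IsManifold.maximalAtlas (𝓡 2) ∞ M)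
    (hu : u ∈ φ.target) (i : Fin 2) :
    inner ℝ (fderiv ℝ (fun v ↦ F (φ.symm v)) u (stdVec i)) (N (φ.symm u)) = 0 := by
  rw [← mfderiv_coordVec hF hφ hu]
  exact hN.normal _ _

theorem differentiableAt_comp_secondFundamentalForm (hF : ContMDiff (𝓡 2) (𝓡 3) ∞ F)
    (hN : ContMDiff (𝓡 2) (𝓡 3) ∞ N) (hφ : φ ∈ IsManifold.maximalAtlas (𝓡 2) ∞ M)
    (hu : u ∈ φ.target) (i j : Fin 2) :
    DifferentiableAt ℝ (comp (secondFundamentalForm F N) φ i j) u :=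
  (differentiableAt_sff (contDiffAt_comp_symm hF hφ hu)
    (contDiffAt_comp_symm hN hφ hu) i j).congr_of_eventuallyEq
    ((eventually_mem_target hu).mono fun _ hv ↦ comp_secondFundamentalForm hF hN hφ hv i j)

theorem IsUnitNormalField.comp_secondFundamentalForm_symm (hN : IsUnitNormalField F N)
    (hF : ContMDiff (𝓡 2) (𝓡 3) ∞ F) (hφ : φ ∈ IsManifold.maximalAtlas (𝓡 2) ∞ M)
    (hu : u ∈ φ.target) (i j : Fin 2) :
    comp (secondFundamentalForm F N) φ i j u = comp (secondFundamentalForm F N) φ j i u := by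
  rw [comp_secondFundamentalForm hF hN.smooth hφ hu, comp_secondFundamentalForm hF hN.smooth hφ hu]
  exact sff_symm (contDiffAt_comp_symm hF hφ hu) (contDiffAt_comp_symm hN.smooth hφ hu)
    ((eventually_mem_target hu).mono fun _ hv ↦ hN.inner_eq_zero hF hφ hv) i j

theorem comp_shapeDistortion (i j : Fin 2) :
    comp (shapeDistortion F₁ N₁ F₂ N₂) φ i j = fun v ↦
      comp (secondFundamentalForm F₁ N₁) φ i j v - comp (secondFundamentalForm F₂ N₂) φ i j v :=
  rfl

variable [IsManifold (𝓡 2) ∞ M] {g : Metric M}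

theorem IsIsometricImmersion.comp_metric (hF : IsIsometricImmersion g F)
    (hφ : φ ∈ IsManifold.maximalAtlas (𝓡 2) ∞ M) (hu : u ∈ φ.target) (i j : Fin 2) :
    comp g.inner φ i j u = gram (fun v ↦ F (φ.symm v)) i j u := by
  rw [gram, ← mfderiv_coordVec hF.smooth hφ hu, ← mfderiv_coordVec hF.smooth hφ hu]
  exact (hF.isometric _ _ _).symm

theorem IsIsometricImmersion.linearIndependent_fderiv (hF : IsIsometricImmersion g F)
    (hφ : φ ∈ IsManifold.maximalAtlas (𝓡 2) ∞ M) (hu : u ∈ φ.target) :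
    LinearIndependent ℝ fun i ↦ fderiv ℝ (fun v ↦ F (φ.symm v)) u (stdVec i) := by
  have hinj : LinearMap.ker (mfderiv (𝓡 2) (𝓡 3) F (φ.symm u)).toLinearMap = ⊥ := by
    rw [LinearMap.ker_eq_bot']
    intro v hv
    by_contra h
    have h1 := hF.isometric (φ.symm u) v v
    have h2 : (mfderiv (𝓡 2) (𝓡 3) F (φ.symm u) v : Space) = 0 := hv
    rw [h2, inner_zero_left] at h1
    exact (g.pos _ v h).ne h1
  have h := (linearIndependent_coordVec hφ hu).map' _ hinj
  have he : (fun i ↦ fderiv ℝ (fun v ↦ F (φ.symm v)) u (stdVec i)) =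
      fun i ↦ (mfderiv (𝓡 2) (𝓡 3) F (φ.symm u) (coordVec φ i u) : Space) :=
    funext fun i ↦ (mfderiv_coordVec hF.smooth hφ hu i).symm
  rw [he]
  exact h

/-- Symmetry is known on the coordinate vectors of a chart; these span the tangent space, so
bilinearity extends it. -/
theorem IsUnitNormalField.secondFundamentalForm_symm (hN : IsUnitNormalField F N)
    (hF : ContMDiff (𝓡 2) (𝓡 3) ∞ F) (U : Set M) :
    IsSymmetricOn (secondFundamentalForm F N) U := by
  intro p _ v w
  have hφ := IsManifold.chart_mem_maximalAtlas (I := 𝓡 2) (n := ∞) p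
  have hu := mem_chart_target Plane p
  have hp := (chartAt Plane p).left_inv (mem_chart_source Plane p)
  -- Replacing `p` by `φ.symm u` puts the point in the form in which coordinate vectors are defined.
  generalize chartAt Plane p = φ at hφ hu hp
  generalize φ p = u at hu hp
  subst hp
  have hspan : ∀ v : TangentSpace (𝓡 2) (φ.symm u),
      ∃ c : Fin 2 → ℝ, v = ∑ i, c i • coordVec φ i u := by
    intro v
    have h1 : Module.finrank ℝ (TangentSpace (𝓡 2) (φ.symm u)) = 2 :=
      finrank_euclideanSpace_fin (𝕜 := ℝ) (n := 2)
    have : FiniteDimensional ℝ (TangentSpace (𝓡 2) (φ.symm u)) :=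
      inferInstanceAs (FiniteDimensional ℝ Plane)
    have h2 := (linearIndependent_coordVec hφ hu).span_eq_top_of_card_eq_finrank' (by simp [h1])
    have h3 : v ∈ Submodule.span ℝ (Set.range fun i ↦ coordVec φ i u) := h2 ▸ Submodule.mem_top
    obtain ⟨c, hc⟩ := (Submodule.mem_span_range_iff_exists_fun ℝ).1 h3
    exact ⟨c, hc.symm⟩
  obtain ⟨c, hc⟩ := hspan v
  obtain ⟨d, hd⟩ := hspan w
  have hB := hN.comp_secondFundamentalForm_symm hF hφ hu 0 1
  simp only [comp] at hB
  simp only [hc, hd, Fin.sum_univ_two, map_add, map_smul, add_apply, smul_apply, smul_eq_mul, hB]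
  ring

/-- The Codazzi equation for an isometric immersion. -/
theorem IsIsometricImmersion.covDeriv_comm (hF : IsIsometricImmersion g F)
    (hN : IsUnitNormalField F N) (hφ : φ ∈ IsManifold.maximalAtlas (𝓡 2) ∞ M)
    (hu : u ∈ φ.target) (k i j : Fin 2) :
    covDeriv g (secondFundamentalForm F N) φ k i j u =
      covDeriv g (secondFundamentalForm F N) φ i k j u := by
  have hev := eventually_mem_target hu
  have hg : ∀ i j, comp g.inner φ i j u = gram (fun v ↦ F (φ.symm v)) i j u :=
    hF.comp_metric hφ hu
  have hdg : ∀ k i j, partialD k (comp g.inner φ i j) u =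
      partialD k (gram (fun v ↦ F (φ.symm v)) i j) u := fun k i j ↦
    partialD_congr (hev.mono fun _ hv ↦ hF.comp_metric hφ hv i j) k
  have hb := comp_secondFundamentalForm hF.smooth hN.smooth hφ hu
  have hdb : ∀ k i j, partialD k (comp (secondFundamentalForm F N) φ i j) u =
      partialD k (sff (fun v ↦ F (φ.symm v)) (fun v ↦ N (φ.symm v)) i j) u := fun k i j ↦
    partialD_congr (hev.mono fun _ hv ↦ comp_secondFundamentalForm hF.smooth hN.smooth hφ hv i j) k
  have hinv : ∀ d b, ∑ x, invMetric g φ u d x * gram (fun v ↦ F (φ.symm v)) x b u =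
      if d = b then 1 else 0 := fun d b ↦ by
    have h := Matrix.nonsing_inv_mul (Matrix.of fun i j ↦ comp g.inner φ i j u)
      (isUnit_iff_ne_zero.2 (metric_comp_det_ne_zero g hφ hu))
    have h' := congrFun (congrFun h d) b
    simp only [Matrix.mul_apply, Matrix.one_apply, Matrix.of_apply, hg] at h'
    simp only [invMetric, hg, h']
  have hsymm : ∀ i j, invMetric g φ u i j = invMetric g φ u j i := fun i j ↦ by
    have h : (Matrix.of fun i j ↦ comp g.inner φ i j u).transpose =
        Matrix.of fun i j ↦ comp g.inner φ i j u := by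
      ext i j
      exact comp_symm (isSymmetricOn_metric g _) hu j i
    have h' := Matrix.transpose_nonsing_inv (Matrix.of fun i j ↦ comp g.inner φ i j u)
    rw [h] at h'
    exact congrFun (congrFun h' j) i
  have h := covDerivAt_sff_comm (contDiffAt_comp_symm hF.smooth hφ hu)
    (contDiffAt_comp_symm hN.smooth hφ hu) hinv hsymm (hF.linearIndependent_fderiv hφ hu)
    (Filter.Eventually.of_forall fun v ↦ hN.norm_eq_one _)
    (hev.mono fun _ hv ↦ hN.inner_eq_zero hF.smooth hφ hv) k i j
  simp only [covDeriv, christoffel, hdg, hb, hdb]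
  exact h

/-- A symmetric trace-free Codazzi tensor is divergence-free. -/
theorem divergence_eq_zero_of_codazzi {S : TwoTensor M} (hsymm : IsSymmetricOn S φ.source)
    (htr : IsTraceFreeOn g S φ.source) (hφ : φ ∈ IsManifold.maximalAtlas (𝓡 2) ∞ M)
    (hu : u ∈ φ.target) (hS : ∀ i j, DifferentiableAt ℝ (comp S φ i j) u)
    (hcod : ∀ k i j, covDeriv g S φ k i j u = covDeriv g S φ i k j u) (j : Fin 2) :
    divergence g S φ j u = 0 := by
  have hev := eventually_mem_target hu
  have hdetne : ∀ {v}, v ∈ φ.target → comp g.inner φ 0 0 v * comp g.inner φ 1 1 v -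
      comp g.inner φ 0 1 v * comp g.inner φ 0 1 v ≠ 0 := fun {v} hv ↦ by
    have h := metric_comp_det_ne_zero g hφ hv
    rw [Matrix.det_fin_two] at h
    simpa [comp_symm (isSymmetricOn_metric g _) hv 1 0] using h
  have hinv : ∀ {v}, v ∈ φ.target → invMetric g φ v =
      (comp g.inner φ 0 0 v * comp g.inner φ 1 1 v -
        comp g.inner φ 0 1 v * comp g.inner φ 0 1 v)⁻¹ •
        !![comp g.inner φ 1 1 v, -comp g.inner φ 0 1 v;
          -comp g.inner φ 0 1 v, comp g.inner φ 0 0 v] := fun {v} hv ↦ by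
    rw [invMetric, Matrix.inv_def, Matrix.det_fin_two, Matrix.adjugate_fin_two]
    simp [comp_symm (isSymmetricOn_metric g _) hv 1 0, Ring.inverse_eq_inv']
  -- The trace multiplied by the Gram determinant is polynomial in the components, so the inverse
  -- metric need not be differentiated.
  have htr0 : ∀ v ∈ φ.target, comp g.inner φ 1 1 v * comp S φ 0 0 v -
      2 * (comp g.inner φ 0 1 v * comp S φ 0 1 v) + comp g.inner φ 0 0 v * comp S φ 1 1 v = 0 := by
    intro v hv
    have h := htr _ (φ.map_target hv)
    rw [trace_eq_comp g S hφ hv, hinv hv] at h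
    simp [Fin.sum_univ_two, comp_symm hsymm hv 1 0] at h
    refine (mul_eq_zero.1 ?_).resolve_left (inv_ne_zero (hdetne hv))
    linear_combination h
  have dg := differentiableAt_metric_comp g hφ hu
  have hdtr : ∀ j, partialD j (comp g.inner φ 1 1) u * comp S φ 0 0 u +
      comp g.inner φ 1 1 u * partialD j (comp S φ 0 0) u -
      2 * (partialD j (comp g.inner φ 0 1) u * comp S φ 0 1 u +
        comp g.inner φ 0 1 u * partialD j (comp S φ 0 1) u) +
      (partialD j (comp g.inner φ 0 0) u * comp S φ 1 1 u +
        comp g.inner φ 0 0 u * partialD j (comp S φ 1 1) u) = 0 := by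
    intro j
    have h := partialD_eq_zero_of_eventually_const (hev.mono htr0) j
    have m := fun a b c d ↦ (dg a b).fun_mul (hS c d)
    rw [partialD_add ((m 1 1 0 0).fun_sub ((m 0 1 0 1).const_mul 2)) (m 0 0 1 1),
      partialD_sub (m 1 1 0 0) ((m 0 1 0 1).const_mul 2),
      partialD_mul (differentiableAt_const 2) (m 0 1 0 1), partialD_mul (dg 1 1) (hS 0 0),
      partialD_mul (dg 0 1) (hS 0 1), partialD_mul (dg 0 0) (hS 1 1)] at h
    simp only [partialD, fderiv_const_apply, zero_apply, zero_mul, zero_add] at h ⊢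
    exact h
  have hcs : ∀ k i j, covDeriv g S φ k i j u = covDeriv g S φ k j i u := by
    intro k i j
    simp only [covDeriv, partialD_comp_symm hsymm hu k i j, comp_symm hsymm hu _ j,
      comp_symm hsymm hu i]
    ring
  have h := contract_covDerivAt_eq_zero (G := fun i j ↦ comp g.inner φ i j u)
    (S := fun i j ↦ comp S φ i j u) (dg := fun k i j ↦ partialD k (comp g.inner φ i j) u)
    (dS := fun k i j ↦ partialD k (comp S φ i j) u)
    (fun k ↦ partialD_comp_symm (isSymmetricOn_metric g _) hu k 1 0) (comp_symm hsymm hu 1 0)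
    (fun k ↦ partialD_comp_symm hsymm hu k 1 0) (hdetne hu) (htr0 u hu) j (hdtr j)
    (Ginv := invMetric g φ u)
    (by simp [hinv hu, div_eq_inv_mul]) (by simp [hinv hu, div_eq_inv_mul])
    (by simp [hinv hu, div_eq_inv_mul]) (by simp [hinv hu, div_eq_inv_mul])
  -- Symmetry in the last two indices followed by Codazzi turns `∇_k S_{ij}` into `∇_j S_{ki}`,
  -- whose contraction is the derivative of the trace.
  refine Eq.trans ?_ h
  refine Finset.sum_congr rfl fun k _ ↦ Finset.sum_congr rfl fun i _ ↦ ?_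
  rw [hcs k i j, hcod k j i]
  rfl

theorem trace_shapeDistortion (p : M) :
    trace g (shapeDistortion F₁ N₁ F₂ N₂) p =
      trace g (secondFundamentalForm F₁ N₁) p - trace g (secondFundamentalForm F₂ N₂) p := by
  have h : ∀ (W : Matrix (Fin 2) (Fin 2) ℝ) (B C : Plane →L[ℝ] Plane →L[ℝ] ℝ),
      ∑ i, ∑ j, W i j * (B - C) (stdVec i) (stdVec j) =
        ∑ i, ∑ j, W i j * B (stdVec i) (stdVec j) - ∑ i, ∑ j, W i j * C (stdVec i) (stdVec j) := by
    intro W B C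
    simp only [sub_apply, Fin.sum_univ_two]
    ring
  exact h _ _ _

theorem isTraceFreeOn_shapeDistortion
    (hH : meanCurvature g F₁ N₁ = meanCurvature g F₂ N₂) (U : Set M) :
    IsTraceFreeOn g (shapeDistortion F₁ N₁ F₂ N₂) U := by
  intro p _
  have h := congrFun hH p
  simp only [meanCurvature] at h
  rw [trace_shapeDistortion]
  linarith

theorem isSymmetricOn_shapeDistortion (hF₁ : IsIsometricImmersion g F₁)
    (hF₂ : IsIsometricImmersion g F₂) (hN₁ : IsUnitNormalField F₁ N₁)
    (hN₂ : IsUnitNormalField F₂ N₂) (U : Set M) :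
    IsSymmetricOn (shapeDistortion F₁ N₁ F₂ N₂) U := fun p hp v w ↦
  congrArg₂ (· - ·) (hN₁.secondFundamentalForm_symm hF₁.smooth U p hp v w)
    (hN₂.secondFundamentalForm_symm hF₂.smooth U p hp v w)

theorem differentiableAt_comp_shapeDistortion (hF₁ : IsIsometricImmersion g F₁)
    (hF₂ : IsIsometricImmersion g F₂) (hN₁ : IsUnitNormalField F₁ N₁)
    (hN₂ : IsUnitNormalField F₂ N₂) (hφ : φ ∈ IsManifold.maximalAtlas (𝓡 2) ∞ M)
    (hu : u ∈ φ.target) (i j : Fin 2) :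
    DifferentiableAt ℝ (comp (shapeDistortion F₁ N₁ F₂ N₂) φ i j) u :=
  (differentiableAt_comp_secondFundamentalForm hF₁.smooth hN₁.smooth hφ hu i j).fun_sub
    (differentiableAt_comp_secondFundamentalForm hF₂.smooth hN₂.smooth hφ hu i j)

/-- The covariant derivative is linear in the tensor, and both Codazzi equations involve the
connection of the one metric `g`, so they subtract. -/
theorem covDeriv_shapeDistortion_comm (hF₁ : IsIsometricImmersion g F₁)
    (hF₂ : IsIsometricImmersion g F₂) (hN₁ : IsUnitNormalField F₁ N₁)
    (hN₂ : IsUnitNormalField F₂ N₂) (hφ : φ ∈ IsManifold.maximalAtlas (𝓡 2) ∞ M)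
    (hu : u ∈ φ.target) (k i j : Fin 2) :
    covDeriv g (shapeDistortion F₁ N₁ F₂ N₂) φ k i j u =
      covDeriv g (shapeDistortion F₁ N₁ F₂ N₂) φ i k j u := by
  have h : ∀ k i j, covDeriv g (shapeDistortion F₁ N₁ F₂ N₂) φ k i j u =
      covDeriv g (secondFundamentalForm F₁ N₁) φ k i j u -
        covDeriv g (secondFundamentalForm F₂ N₂) φ k i j u := by
    intro k i j
    simp only [covDeriv, comp_shapeDistortion, Fin.sum_univ_two]
    rw [partialD_sub
      (differentiableAt_comp_secondFundamentalForm hF₁.smooth hN₁.smooth hφ hu i j)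
      (differentiableAt_comp_secondFundamentalForm hF₂.smooth hN₂.smooth hφ hu i j)]
    ring
  rw [h, h, hF₁.covDeriv_comm hN₁ hφ hu, hF₂.covDeriv_comm hN₂ hφ hu]

theorem isDivergenceFreeOn_shapeDistortion (hF₁ : IsIsometricImmersion g F₁)
    (hF₂ : IsIsometricImmersion g F₂) (hN₁ : IsUnitNormalField F₁ N₁)
    (hN₂ : IsUnitNormalField F₂ N₂)
    (hH : meanCurvature g F₁ N₁ = meanCurvature g F₂ N₂) (U : Set M) :
    IsDivergenceFreeOn g (shapeDistortion F₁ N₁ F₂ N₂) U := fun φ hφ p hp j ↦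
  have hu : φ p ∈ φ.target := φ.map_source hp.1
  divergence_eq_zero_of_codazzi (isSymmetricOn_shapeDistortion hF₁ hF₂ hN₁ hN₂ _)
    (isTraceFreeOn_shapeDistortion hH _) hφ hu
    (differentiableAt_comp_shapeDistortion hF₁ hF₂ hN₁ hN₂ hφ hu)
    (covDeriv_shapeDistortion_comm hF₁ hF₂ hN₁ hN₂ hφ hu) j

end Immersion

end BonnetSurface

theorem mainTheorem10 {M : Type*} [TopologicalSpace M]
    [ChartedSpace BonnetSurface.Plane M] [IsManifold (𝓡 2) ∞ M]
    (o : BonnetSurface.OrientedAtlas M) (g : BonnetSurface.Metric M) :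
    (∀ F₁ F₂ N₁ N₂ : M → BonnetSurface.Space,
      BonnetSurface.IsIsometricImmersion g F₁ →
      BonnetSurface.IsIsometricImmersion g F₂ →
      BonnetSurface.IsUnitNormalField F₁ N₁ →
      BonnetSurface.IsUnitNormalField F₂ N₂ →
      BonnetSurface.meanCurvature g F₁ N₁ = BonnetSurface.meanCurvature g F₂ N₂ →
        BonnetSurface.IsTraceFreeOn g
          (BonnetSurface.shapeDistortion F₁ N₁ F₂ N₂) Set.univ ∧
        BonnetSurface.IsDivergenceFreeOn g
          (BonnetSurface.shapeDistortion F₁ N₁ F₂ N₂) Set.univ ∧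
        BonnetSurface.IsHolomorphicTwoZero g o
          (BonnetSurface.shapeDistortion F₁ N₁ F₂ N₂)) ∧
    (∀ (S : BonnetSurface.TwoTensor M) (z : OpenPartialHomeomorph M BonnetSurface.Plane),
      BonnetSurface.IsIsothermal g o z →
      BonnetSurface.IsC1On S z.source →
      BonnetSurface.IsSymmetricOn S z.source →
      BonnetSurface.IsTraceFreeOn g S z.source →
        (BonnetSurface.IsDivergenceFreeOn g S z.source ↔
          BonnetSurface.IsHolomorphicIn S z)) := by
  refine ⟨fun F₁ F₂ N₁ N₂ hF₁ hF₂ hN₁ hN₂ hH ↦ ?_, fun S z hz hS hsymm htr ↦ ?_⟩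
  · have hdiv := fun U ↦
      BonnetSurface.isDivergenceFreeOn_shapeDistortion hF₁ hF₂ hN₁ hN₂ hH U
    refine ⟨BonnetSurface.isTraceFreeOn_shapeDistortion hH _, hdiv _, fun z hz ↦ ?_⟩
    -- The equivalence asks only for differentiable components, so `C¹` regularity of `D` as a
    -- bundle section is not needed here.
    exact (hz.isDivergenceFreeOn_iff_isHolomorphicIn
      (fun i j u hu ↦ BonnetSurface.differentiableAt_comp_shapeDistortion hF₁ hF₂ hN₁ hN₂
        hz.smooth hu i j)
      (BonnetSurface.isSymmetricOn_shapeDistortion hF₁ hF₂ hN₁ hN₂ _)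
      (BonnetSurface.isTraceFreeOn_shapeDistortion hH _)).1 (hdiv _)
  · exact hz.isDivergenceFreeOn_iff_isHolomorphicIn
      (fun i j u hu ↦ ((BonnetSurface.contDiffOn_comp hz.smooth hS i j).differentiableOn
        (by simp)).differentiableAt (z.open_target.mem_nhds hu)) hsymm htr
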